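/- Proposition 4.4 (dense regime). For $k\ge 2$ and parameters $p,q,s\in(0,1)$, let $\mathsf{SignedBlock}_k(p,q,s)$ be the following random signed graph on the node set $[2k]$, partitioned into $[k]$ and $[2k]\setminus[k]$. Independently for every pair $\{i,j\}$ of distinct nodes, $\{i,j\}$ is an edge with probability $p_{ij}$, where $p_{ij}=p$ if $i,j$ lie in the same part and $p_{ij}=q$ otherwise; independently of everything else, the pair receives a negative sign with probability $s_{ij}$, and a positive sign otherwise, where $s_{ij}=s$ if $i,j$ lie in the same part and $s_{ij}=1-s$ otherwise. Put $p_{ii}=s_{ii}=0$. Let $A$ be the signed adjacency matrix ($a_{ij}=\pm1$ is the sign of the edge $\{i,j\}$, and $a_{ij}=0$ if $\{i,j\}$ is not an edge), let $D$ be the diagonal matrix of the node degrees, and let $\mathcal{L}=D^{-1/2}(D-A)D^{-1/2}$ be the normalized signed Laplacian, where $(D^{-1/2})_{ii}=0$ if node $i$ has degree $0$. Let $\overline{A}=(p_{ij}(1-2s_{ij}))_{i,j}$, $\overline{D}=\mathrm{diag}\big(\sum_j p_{ij}\big)_i$ and $\overline{\mathcal{L}}=\overline{D}^{-1/2}(\overline{D}-\overline{A})\overline{D}^{-1/2}$.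 Fix $\gamma_1>\gamma_2>0$ and $0<s<1/2$. Then there is a constant $C=C(\gamma_1,\gamma_2,s)>0$ such that for all sufficiently large $k$ (depending on $\gamma_1,\gamma_2,s$), if the random signed graph is drawn from $\mathsf{SignedBlock}_k(\gamma_1k^{-1/2},\gamma_2k^{-1/2},s)$, then with probability at least $1-k^{-2}$, $$\|\mathcal{L}-\overline{\mathcal{L}}\|_{\mathrm{op}}\le C\,k^{-1/4},$$ where $\|\cdot\|_{\mathrm{op}}$ is the $\ell_2$-operator (spectral) norm. -/

import Mathlib

open MeasureTheory ProbabilityTheory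

namespace SignedER

/-- A signed graph on the node set `V`: a simple graph together with a signature
`σ : E → {±1}`. -/
structure SignedGraph (V : Type*) where
  graph : SimpleGraph V
  sign : graph.edgeSet → ℤˣ

/-- The discrete σ-algebra on signed graphs (only used for finite node sets). -/
instance (V : Type*) : MeasurableSpace (SignedGraph V) := ⊤

section Matrices

variable {V : Type*}

open Classical in
/-- The signed adjacency matrix: `a i j = σ {i,j}` if `i ∼ j`, and `0` otherwise. -/
noncomputable def SignedGraph.adj (G : SignedGraph V) : Matrix V V ℝ :=
  Matrix.of fun i j => if h : G.graph.Adj i j then (((G.sign ⟨s(i, j), h⟩ : ℤˣ) : ℤ) : ℝ) else 0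

variable [Fintype V] [DecidableEq V]

open Classical in
/-- The degree of a node: the number of edges incident to it. -/
noncomputable def SignedGraph.degree (G : SignedGraph V) (i : V) : ℝ := (G.graph.degree i : ℝ)

/-- `D^{-1/2}` for the diagonal matrix `D = diag d`, with the convention that a diagonal entry is
`0` where `d i = 0` (in Lean `(√0)⁻¹ = 0`). -/
noncomputable def invSqrtDiag (d : V → ℝ) : Matrix V V ℝ :=
  Matrix.diagonal fun i => (Real.sqrt (d i))⁻¹

/-- `D^{-1/2} (D - A) D^{-1/2}` for `D = diag d`. -/
noncomputable def normalizedLaplacianOf (d : V → ℝ) (A : Matrix V V ℝ) : Matrix V V ℝ :=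
  invSqrtDiag d * (Matrix.diagonal d - A) * invSqrtDiag d

/-- The normalized signed Laplacian `𝓛 = D^{-1/2} (D - A) D^{-1/2}` of a signed graph. -/
noncomputable def SignedGraph.normalizedLaplacian (G : SignedGraph V) : Matrix V V ℝ :=
  normalizedLaplacianOf G.degree G.adj

/-- The mean signed adjacency matrix of the model with edge probabilities `P` and sign
probabilities `S`: entries `p i j * (1 - 2 * s i j)`. -/
def meanAdj (P S : Matrix V V ℝ) : Matrix V V ℝ :=
  Matrix.of fun i j => P i j * (1 - 2 * S i j)

/-- The expected degree of node `i`. -/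
def meanDegree (P : Matrix V V ℝ) (i : V) : ℝ := ∑ j, P i j

/-- The degree-normalized mean Laplacian `D̄^{-1/2} (D̄ - Ā) D̄^{-1/2}`. -/
noncomputable def meanNormalizedLaplacian (P S : Matrix V V ℝ) : Matrix V V ℝ :=
  normalizedLaplacianOf (meanDegree P) (meanAdj P S)

/-- The `ℓ²`-operator (spectral) norm of a square real matrix. -/
noncomputable def opNorm (M : Matrix V V ℝ) : ℝ := ‖Matrix.toEuclideanCLM (𝕜 := ℝ) M‖

end Matrices

/-- The unordered pairs of distinct elements of `[n]`. -/
abbrev Pair (n : ℕ) : Type := {e : Sym2 (Fin n) // ¬ e.IsDiag}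

/-- The signed graph determined by two families of coins: the pair `e` is an edge iff
`(x e).1 = true`, and an edge `e` has negative sign iff `(x e).2 = true`. -/
def graphOfCoins {n : ℕ} (x : Pair n → Bool × Bool) : SignedGraph (Fin n) where
  graph :=
    { Adj := fun i j => ∃ h : ¬ (s(i, j) : Sym2 (Fin n)).IsDiag, (x ⟨s(i, j), h⟩).1 = true
      symm := ⟨fun i j h => by
        have e : s(i, j) = s(j, i) := Sym2.eq_swap
        rwa [e] at h⟩
      loopless := ⟨fun i h => h.1 rfl⟩ }
  sign := fun e => if ∃ h : ¬ e.1.IsDiag, (x ⟨e.1, h⟩).2 = true then -1 else 1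

/-- The law on `Bool` of a Bernoulli variable with success probability `p ∈ [0, 1]`
(a real `p` outside `[0, 1]` is clamped to that interval). -/
noncomputable def coin (p : ℝ) : Measure Bool :=
  bernoulliMeasure true false (Set.projIcc (0 : ℝ) 1 zero_le_one p)

/-- The signed inhomogeneous Erdős–Rényi model `G_n(P, S)`, as a law on signed graphs on `[n]`,
for symmetric matrices `P`, `S` of probabilities: all pairs `{i, j}` and all signs are
sampled mutually independently, `{i, j}` being an edge with probability `P i j` and carrying a
negative sign with probability `S i j`. (`e.inf` and `e.sup` are the smaller and the larger
element of the pair `e`.) -/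
noncomputable def signedErdosRenyi {n : ℕ} (P S : Matrix (Fin n) (Fin n) ℝ) :
    Measure (SignedGraph (Fin n)) :=
  (Measure.pi fun e : Pair n =>
    (coin (P e.1.inf e.1.sup)).prod (coin (S e.1.inf e.1.sup))).map graphOfCoins

/-- Extension of an `m × m` matrix of cluster probabilities to an `n × n` matrix with zero
diagonal, where `c i` is the cluster of node `i`. -/
def blockExtend {n m : ℕ} (c : Fin n → Fin m) (Q : Matrix (Fin m) (Fin m) ℝ) :
    Matrix (Fin n) (Fin n) ℝ :=
  Matrix.of fun i j => if i = j then 0 else Q (c i) (c j)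

/-- The even bipartition of `2k` nodes into the first `k` and the last `k`. -/
def bisection (k : ℕ) (i : Fin (2 * k)) : Fin 2 := if (i : ℕ) < k then 0 else 1

/-- Edge probabilities of the bisection model: `p` within, `q` between the communities. -/
def edgeProb (k : ℕ) (p q : ℝ) : Matrix (Fin (2 * k)) (Fin (2 * k)) ℝ :=
  blockExtend (bisection k) !![p, q; q, p]

/-- Negative sign probabilities of the bisection model: `s` within, `1 - s` between the
communities. -/
def signProb (k : ℕ) (s : ℝ) : Matrix (Fin (2 * k)) (Fin (2 * k)) ℝ :=
  blockExtend (bisection k) !![s, 1 - s; 1 - s, s]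

/-- The signed stochastic bisection model `SignedBlock_k(p, q, s)`. -/
noncomputable def signedBlock (k : ℕ) (p q s : ℝ) : Measure (SignedGraph (Fin (2 * k))) :=
  signedErdosRenyi (edgeProb k p q) (signProb k s)

/-- The degree-normalized mean Laplacian of `SignedBlock_k(p, q, s)`. -/
noncomputable def signedBlockMeanLaplacian (k : ℕ) (p q s : ℝ) :
    Matrix (Fin (2 * k)) (Fin (2 * k)) ℝ :=
  meanNormalizedLaplacian (edgeProb k p q) (signProb k s)

end SignedER

/-! Write n for the number of nodes, p for the largest edge probability and m for a lower bound on
the expected degrees; here np and m are both of order √k. When all degrees are positive the identity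
parts of the two Laplacians cancel. The difference then splits into D^{-1/2}(A − Ā)D^{-1/2} and the
error of replacing D by D̄ around Ā. Let E be the centred edge matrix. The vector of degree errors
is E·1, with ℓ² norm at most ‖E‖√n, and the entries of Ā are at most p, so a Frobenius estimate
handles the second term (`opNorm_normalizedLaplacianOf_sub_le`). If ‖A − Ā‖ and ‖E‖ are O(√(np)),
both terms are O(√(np)/m) = O(k^{-1/4}). A Chernoff and union bound keeps every degree above half
its mean (`measure_degree_le`).

The bound O(√(np)) must hold without a logarithmic loss; it comes from the trace method. For
independent centred entries of variance at most ρ, the N-th trace moment is bounded by closed walks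
using each edge at least twice, weighted by ρ^(vertices − 1) (`integral_trace_pow_le`). Relabelling
vertices reduces this sum, once nρ ≤ N, to n times the number of such walks on only 2N vertices
(`sum_good_walks_le`). That number is not found by combinatorics: it is at most the mean trace of
the N-th power of a random matrix whose entries have nonnegative moments (`card_good_walks_le`). In
dimension 2N an ε-net has only exponentially many points in N, so the net argument costs a factor
const^N and gives (C√N)^N up to such factors (`card_good_walks_fin_le`). Markov's inequality with N
comparable to nρ then yields the tail (`exists_opNorm_pairMatrix_tail`). -/

namespace SignedER

/-! ### Traces of powers as sums over closed walks -/

/-- The product of the entries of `M` along the walk `w`. -/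
def walkWeight {V : Type*} (M : Matrix V V ℝ) {N : ℕ} (w : Fin (N + 1) → V) : ℝ :=
  ∏ i : Fin N, M (w i.castSucc) (w i.succ)

theorem pow_apply_eq_sum_walkWeight {V : Type*} [Fintype V] [DecidableEq V]
    (M : Matrix V V ℝ) (N : ℕ) (a b : V) :
    (M ^ N) a b = ∑ w : Fin (N + 1) → V,
      if w 0 = a ∧ w (Fin.last N) = b then walkWeight M w else 0 := by
  induction N generalizing a with
  | zero =>
    rw [← (Equiv.funUnique (Fin 1) V).symm.sum_comp]
    simp [walkWeight, Matrix.one_apply, Finset.filter_and, Finset.filter_eq']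
    split_ifs <;> simp_all
  | succ N ih =>
    rw [pow_succ', Matrix.mul_apply, ← (Fin.consEquiv (fun _ : Fin (N + 2) => V)).sum_comp,
      Fintype.sum_prod_type_right]
    simp_rw [ih, Finset.mul_sum]
    rw [Finset.sum_comm]
    refine Finset.sum_congr rfl fun w _ => ?_
    rw [Finset.sum_eq_single (w 0), Finset.sum_eq_single a]
    · simp only [Fin.consEquiv, Equiv.coe_fn_mk, Fin.cons_zero, ← Fin.succ_last, Fin.cons_succ,
        true_and, walkWeight, Fin.prod_univ_succ, mul_ite, mul_zero, Fin.castSucc_zero,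
        ← Fin.succ_castSucc]
    · intro c _ hc
      simp [Fin.consEquiv, hc]
    · simp
    · intro c _ hc
      simp [hc.symm]
    · simp

theorem trace_pow_eq_sum_walkWeight {V : Type*} [Fintype V] [DecidableEq V]
    (M : Matrix V V ℝ) (N : ℕ) :
    (M ^ N).trace = ∑ w : Fin (N + 1) → V,
      if w 0 = w (Fin.last N) then walkWeight M w else 0 := by
  simp_rw [Matrix.trace, Matrix.diag, pow_apply_eq_sum_walkWeight]
  rw [Finset.sum_comm]
  refine Finset.sum_congr rfl fun w _ => ?_
  rw [Finset.sum_eq_single (w 0)]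
  · simp [eq_comm]
  · intro c _ hc
    simp [hc.symm]
  · simp

/-! ### Good walks and their compression to a small vertex set -/

/-- The number of functions with the same kernel as a given one. -/
theorem card_filter_same_kernel {ι α β : Type*} [Fintype ι] [DecidableEq ι] [Fintype α]
    [DecidableEq β] (u : ι → β)
    [DecidablePred fun w : ι → α => ∀ i j, w i = w j ↔ u i = u j] :
    (Finset.univ.filter fun w : ι → α => ∀ i j, w i = w j ↔ u i = u j).card =
      (Fintype.card α).descFactorial (Finset.univ.image u).card := by
  classical
  -- Each such `w` is `u` followed by a unique injection of the range of `u`.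
  have e : {w : ι → α // ∀ i j, w i = w j ↔ u i = u j} ≃ (Set.range u ↪ α) :=
    { toFun := fun w => ⟨fun y => w.1 y.2.choose, by
        rintro ⟨y, hy⟩ ⟨z, hz⟩ h
        have := (w.2 _ _).1 h
        rw [hy.choose_spec, hz.choose_spec] at this
        exact Subtype.ext this⟩
      invFun := fun f => ⟨fun i => f ⟨u i, Set.mem_range_self i⟩, fun i j => by
        rw [f.injective.eq_iff, Subtype.mk.injEq]⟩
      left_inv := by
        rintro ⟨w, hw⟩
        refine Subtype.ext (funext fun i => ?_)
        have h : ∃ j, u j = u i := ⟨i, rfl⟩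
        exact (hw _ _).2 h.choose_spec
      right_inv := by
        intro f
        ext ⟨y, hy⟩
        exact congrArg f (Subtype.ext hy.choose_spec) }
  rw [← Fintype.card_subtype, Fintype.card_congr e, Fintype.card_embedding_eq]
  congr 1
  rw [← Set.toFinset_card, Set.toFinset_range]

/-- A closed walk without stationary steps that traverses each of its edges at least twice. -/
def IsGoodWalk {V : Type*} {N : ℕ} (w : Fin (N + 1) → V) : Prop :=
  w 0 = w (Fin.last N) ∧ (∀ i : Fin N, w i.castSucc ≠ w i.succ) ∧
    ∀ i : Fin N, ∃ j, j ≠ i ∧ s(w i.castSucc, w i.succ) = s(w j.castSucc, w j.succ)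

/-- Goodness depends only on which positions share a vertex, so it survives a change of vertex set.
-/
theorem IsGoodWalk.congr {V V' : Type*} {N : ℕ} {w : Fin (N + 1) → V} {u : Fin (N + 1) → V'}
    (h : ∀ i j, w i = w j ↔ u i = u j) (hw : IsGoodWalk w) : IsGoodWalk u := by
  refine ⟨(h _ _).1 hw.1, fun i hi => hw.2.1 i ((h _ _).2 hi), fun i => ?_⟩
  obtain ⟨j, hj, he⟩ := hw.2.2 i
  refine ⟨j, hj, ?_⟩
  rw [Sym2.eq_iff] at he ⊢
  simpa only [h] using he

/-- A walk visits at most one vertex more than it has distinct edges. -/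
theorem card_image_le_card_edges_add_one {V : Type*} [DecidableEq V] {N : ℕ}
    (w : Fin (N + 1) → V) :
    (Finset.univ.image w).card ≤
      (Finset.univ.image fun i : Fin N => s(w i.castSucc, w i.succ)).card + 1 := by
  induction N with
  | zero => exact (Finset.card_image_le).trans (by simp)
  | succ N ih =>
    have h := ih (fun i => w i.succ)
    set T := Finset.univ.image fun i : Fin (N + 1) => w i.succ with hT
    set F := Finset.univ.image fun i : Fin N => s(w i.castSucc.succ, w i.succ.succ) with hF
    have h1 : Finset.univ.image w = insert (w 0) T := by
      ext v
      simp [hT, Fin.exists_fin_succ, eq_comm]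
    have h2 : (Finset.univ.image fun i : Fin (N + 1) => s(w i.castSucc, w i.succ)) =
        insert s(w 0, w 1) F := by
      ext v
      simp [hF, Fin.exists_fin_succ, eq_comm]
    rw [h1, h2]
    -- Prepending a step to the walk: a new first vertex forces a new first edge, since every later
    -- edge has both ends in `T`.
    by_cases h0 : w 0 ∈ T
    · rw [Finset.insert_eq_of_mem h0]
      exact h.trans (Nat.add_le_add_right (Finset.card_le_card (Finset.subset_insert _ _)) 1)
    · have h3 : s(w 0, w 1) ∉ F := by
        intro h3
        obtain ⟨i, -, hi⟩ := Finset.mem_image.1 h3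
        apply h0
        rw [Sym2.eq_iff] at hi
        rcases hi with hi | hi
        · exact Finset.mem_image.2 ⟨i.castSucc, Finset.mem_univ _, hi.1⟩
        · exact Finset.mem_image.2 ⟨i.succ, Finset.mem_univ _, hi.2⟩
      rw [Finset.card_insert_of_notMem h0, Finset.card_insert_of_notMem h3]
      omega

open Classical in
/-- Compression: the weighted count of good walks in `α` is controlled by the number of good walks
in a set `β` whose size exceeds `ρ * card α` by the length of the walk. -/
theorem sum_good_walks_le {α β : Type*} [Fintype α] [Fintype β] (N : ℕ) {ρ : ℝ} (hρ : 0 ≤ ρ)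
    (hN : N < Fintype.card β)
    (h : Fintype.card α * ρ ≤ (Fintype.card β : ℝ) - N) :
    ∑ w : Fin (N + 1) → α with IsGoodWalk w, ρ ^ ((Finset.univ.image w).card - 1) ≤
      Fintype.card α * (Finset.univ.filter fun u : Fin (N + 1) → β => IsGoodWalk u).card := by
  have hv : ∀ (w : Fin (N + 1) → α), (Finset.univ.image w).card ≤ N + 1 := fun w =>
    Finset.card_image_le.trans (by simp)
  have hv₂ : ∀ (u : Fin (N + 1) → β),
      1 ≤ (Finset.univ.image u).card ∧ (Finset.univ.image u).card ≤ N + 1 := fun u =>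
    ⟨Finset.card_pos.2 (by simp), Finset.card_image_le.trans (by simp)⟩
  have hcard : ∀ (w : Fin (N + 1) → α) (u : Fin (N + 1) → β), (∀ i j, w i = w j ↔ u i = u j) →
      (Finset.univ.image w).card = (Finset.univ.image u).card := by
    intro w u hwu
    refine Finset.card_bij' (fun y hy => u (Finset.mem_image.1 hy).choose)
      (fun y hy => w (Finset.mem_image.1 hy).choose) ?_ ?_ ?_ ?_
    · simp
    · simp
    · intro y hy
      have h1 := (Finset.mem_image.1 hy).choose_spec
      conv_rhs => rw [← h1.2]
      rw [hwu]
      exact (Finset.mem_image.1 (Finset.mem_image_of_mem u (Finset.mem_univ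
        (Finset.mem_image.1 hy).choose))).choose_spec.2
    · intro y hy
      have h1 := (Finset.mem_image.1 hy).choose_spec
      conv_rhs => rw [← h1.2]
      rw [← hwu]
      exact (Finset.mem_image.1 (Finset.mem_image_of_mem w (Finset.mem_univ
        (Finset.mem_image.1 hy).choose))).choose_spec.2
  set n := Fintype.card α
  set r := Fintype.card β
  have hpos : ∀ v, v ≤ N + 1 → (0 : ℝ) < r.descFactorial v := by
    intro v hv
    exact_mod_cast Nat.descFactorial_pos.2 (by omega)
  -- Double counting: the weight of `w` is spread evenly over the walks `u` in `β` with the same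
  -- kernel, and the sums are exchanged.
  calc ∑ w : Fin (N + 1) → α with IsGoodWalk w, ρ ^ ((Finset.univ.image w).card - 1)
      = ∑ w : Fin (N + 1) → α with IsGoodWalk w,
          ∑ u : Fin (N + 1) → β with ∀ i j, u i = u j ↔ w i = w j,
          ρ ^ ((Finset.univ.image w).card - 1) / r.descFactorial (Finset.univ.image w).card := by
        refine Finset.sum_congr rfl fun w _ => ?_
        rw [Finset.sum_const, card_filter_same_kernel, nsmul_eq_mul,
          mul_div_cancel₀ _ (hpos _ (hv w)).ne']
    _ = ∑ u : Fin (N + 1) → β with IsGoodWalk u,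
          ∑ w : Fin (N + 1) → α with ∀ i j, w i = w j ↔ u i = u j,
          ρ ^ ((Finset.univ.image u).card - 1) / r.descFactorial (Finset.univ.image u).card := by
        rw [Finset.sum_comm' (s' := fun u => Finset.univ.filter fun w : Fin (N + 1) → α =>
          ∀ i j, w i = w j ↔ u i = u j) (t' := Finset.univ.filter fun u => IsGoodWalk u)]
        · refine Finset.sum_congr rfl fun u _ => Finset.sum_congr rfl fun w hw => ?_
          rw [hcard w u (Finset.mem_filter.1 hw).2]
        · intro w u
          simp only [Finset.mem_filter, Finset.mem_univ, true_and]
          constructor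
          · rintro ⟨h1, h2⟩
            exact ⟨fun i j => (h2 i j).symm, h1.congr fun i j => (h2 i j).symm⟩
          · rintro ⟨h1, h2⟩
            exact ⟨h2.congr fun i j => (h1 i j).symm, fun i j => (h1 i j).symm⟩
    _ ≤ ∑ u : Fin (N + 1) → β with IsGoodWalk u, (n : ℝ) := by
        -- With v + 1 vertices, `u` receives at most n^(v+1) ρ^v / r(r−1)⋯(r−v). The denominator is
        -- at least (r−v)^(v+1), while nρ ≤ r − N ≤ r − v, so at most n remains.
        refine Finset.sum_le_sum fun u _ => ?_
        obtain ⟨h1, h2⟩ := hv₂ u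
        rw [Finset.sum_const, card_filter_same_kernel, nsmul_eq_mul, ← mul_div_assoc,
          div_le_iff₀ (hpos _ h2)]
        obtain ⟨v, hv⟩ : ∃ v, (Finset.univ.image u).card = v + 1 := ⟨_, (Nat.sub_add_cancel h1).symm⟩
        rw [hv] at h2 ⊢
        have h3 : (n.descFactorial (v + 1) : ℝ) ≤ n ^ (v + 1) := by
          exact_mod_cast Nat.descFactorial_le_pow n (v + 1)
        have h4 : ((r - v : ℕ) : ℝ) ^ (v + 1) ≤ r.descFactorial (v + 1) := by
          have := Nat.pow_sub_le_descFactorial r (v + 1)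
          rw [Nat.add_sub_add_right] at this
          exact_mod_cast this
        have h5 : (n : ℝ) * ρ ≤ ((r - v : ℕ) : ℝ) := by
          rw [Nat.cast_sub (by omega)]
          have : (v : ℝ) ≤ N := by exact_mod_cast (by omega : v ≤ N)
          linarith
        have h6 : (1 : ℝ) ≤ ((r - v : ℕ) : ℝ) := by
          exact_mod_cast (by omega : 1 ≤ r - v)
        calc (n.descFactorial (v + 1) : ℝ) * ρ ^ (v + 1 - 1) ≤ n ^ (v + 1) * ρ ^ v := by
              rw [Nat.add_sub_cancel]; gcongr
          _ = n * (n * ρ) ^ v := by rw [mul_pow]; ring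
          _ ≤ n * ((r - v : ℕ) : ℝ) ^ (v + 1) := by
              gcongr
              calc (n * ρ) ^ v ≤ ((r - v : ℕ) : ℝ) ^ v := by gcongr
                _ ≤ _ := pow_le_pow_right₀ h6 (Nat.le_succ v)
          _ ≤ _ := by gcongr
    _ = _ := by rw [Finset.sum_const, nsmul_eq_mul, mul_comm]

/-! ### Trace moments of matrices with independent centred entries -/

theorem prod_comp_eq_prod_pow_card {ι E R : Type*} [Fintype ι] [Fintype E] [DecidableEq E]
    [CommMonoid R] (e : ι → E) (f : E → R) :
    ∏ i, f (e i) = ∏ a, f a ^ (Finset.univ.filter fun i => e i = a).card := by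
  rw [← Finset.prod_fiberwise Finset.univ e]
  refine Finset.prod_congr rfl fun a _ => ?_
  rw [← Finset.prod_const]
  exact Finset.prod_congr rfl fun i hi => by rw [(Finset.mem_filter.1 hi).2]

/-- The symmetric matrix with zero diagonal and entries `g e (x e)` above it. -/
def pairMatrix {Ω : Type*} {n : ℕ} (g : Pair n → Ω → ℝ) (x : Pair n → Ω) : Matrix (Fin n) (Fin n) ℝ :=
  Matrix.of fun i j => if h : ¬ (s(i, j) : Sym2 (Fin n)).IsDiag then
    g ⟨s(i, j), h⟩ (x ⟨s(i, j), h⟩) else 0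

theorem pairMatrix_isSymm {Ω : Type*} {n : ℕ} (g : Pair n → Ω → ℝ) (x : Pair n → Ω) :
    (pairMatrix g x).IsSymm := by
  refine Matrix.IsSymm.ext fun i j => ?_
  have e : (s(i, j) : Sym2 (Fin n)) = s(j, i) := Sym2.eq_swap
  simp only [pairMatrix, Matrix.of_apply, e]

section Moments

variable {Ω : Type*} [Finite Ω] [MeasurableSpace Ω] [MeasurableSingletonClass Ω]

theorem abs_integral_pow_le (ν : Measure Ω) [IsProbabilityMeasure ν] {f : Ω → ℝ} {ρ : ℝ}
    (h1 : ∀ x, |f x| ≤ 1) (h2 : ∫ x, f x ^ 2 ∂ν ≤ ρ) {c : ℕ} (hc : 2 ≤ c) :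
    |∫ x, f x ^ c ∂ν| ≤ ρ := by
  refine (abs_integral_le_integral_abs).trans (le_trans ?_ h2)
  refine integral_mono (Integrable.of_finite) (Integrable.of_finite) fun x => ?_
  rw [abs_pow, ← sq_abs]
  exact pow_le_pow_of_le_one (abs_nonneg _) (h1 x) hc

open Classical in
/-- Moments of a product of independent centred bounded variables: they vanish unless every
factor is repeated, and are bounded by the product of the variances otherwise. -/
theorem abs_integral_prod_le {E ι : Type*} [Fintype E] [Fintype ι] (ν : E → Measure Ω)
    [∀ a, IsProbabilityMeasure (ν a)] {g : E → Ω → ℝ} {ρ : ℝ}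
    (h0 : ∀ a, ∫ x, g a x ∂(ν a) = 0) (h1 : ∀ a x, |g a x| ≤ 1)
    (h2 : ∀ a, ∫ x, g a x ^ 2 ∂(ν a) ≤ ρ) (e : ι → E) :
    |∫ x : E → Ω, ∏ i, g (e i) (x (e i)) ∂(Measure.pi ν)| ≤
      if ∀ i, ∃ j, j ≠ i ∧ e i = e j then ρ ^ (Finset.univ.image e).card else 0 := by
  have key : ∫ x : E → Ω, ∏ i, g (e i) (x (e i)) ∂(Measure.pi ν) =
      ∏ a, ∫ x, g a x ^ (Finset.univ.filter fun i => e i = a).card ∂(ν a) := by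
    rw [← integral_fintype_prod_eq_prod]
    exact integral_congr_ae (ae_of_all _ fun x =>
      prod_comp_eq_prod_pow_card e fun a => g a (x a))
  rw [key]
  split_ifs with h
  · rw [Finset.abs_prod, ← Finset.prod_const,
      ← Finset.prod_subset (Finset.subset_univ (Finset.univ.image e))]
    · refine Finset.prod_le_prod (fun _ _ => abs_nonneg _) fun a ha => ?_
      obtain ⟨i, -, rfl⟩ := Finset.mem_image.1 ha
      obtain ⟨j, hj, hij⟩ := h i
      refine abs_integral_pow_le (ν _) (h1 _) (h2 _) (Finset.one_lt_card.2 ⟨i, ?_, j, ?_, hj.symm⟩)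
      · simp
      · simp [hij]
    · intro a _ ha
      have : (Finset.univ.filter fun i => e i = a) = ∅ := by
        refine Finset.filter_eq_empty_iff.2 fun i _ hi => ha ?_
        exact Finset.mem_image.2 ⟨i, Finset.mem_univ _, hi⟩
      simp [this]
  · push Not at h
    obtain ⟨i, hi⟩ := h
    rw [Finset.prod_eq_zero (Finset.mem_univ (e i)), abs_zero]
    have : (Finset.univ.filter fun j => e j = e i) = {i} := by
      ext j
      simp only [Finset.mem_filter, Finset.mem_univ, true_and, Finset.mem_singleton]
      exact ⟨fun hj => by_contra fun hne => hi j hne hj.symm, fun hj => by rw [hj]⟩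
    simp [this, h0]

-- By independence and centring only good walks have nonzero expectation, and theirs is at most
-- ρ^(distinct edges). As ρ ≤ 1 and a walk has at least as many edges as vertices minus one, the
-- edge count may be replaced by that vertex count.
open Classical in
theorem integral_trace_pow_le {n N : ℕ} (ν : Pair n → Measure Ω)
    [∀ a, IsProbabilityMeasure (ν a)] {g : Pair n → Ω → ℝ} {ρ : ℝ} (hρ : 0 ≤ ρ) (hρ1 : ρ ≤ 1)
    (h0 : ∀ a, ∫ x, g a x ∂(ν a) = 0) (h1 : ∀ a x, |g a x| ≤ 1)
    (h2 : ∀ a, ∫ x, g a x ^ 2 ∂(ν a) ≤ ρ) :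
    ∫ x, (pairMatrix g x ^ N).trace ∂(Measure.pi ν) ≤
      ∑ w : Fin (N + 1) → Fin n with IsGoodWalk w, ρ ^ ((Finset.univ.image w).card - 1) := by
  simp_rw [trace_pow_eq_sum_walkWeight]
  rw [integral_finsetSum _ fun _ _ => Integrable.of_finite, Finset.sum_filter]
  refine Finset.sum_le_sum fun w _ => ?_
  by_cases hw : w 0 = w (Fin.last N)
  swap
  · simp [hw, IsGoodWalk]
  by_cases hd : ∀ i : Fin N, w i.castSucc ≠ w i.succ
  swap
  · push Not at hd
    obtain ⟨i, hi⟩ := hd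
    have : ∀ x, walkWeight (pairMatrix g x) w = 0 := fun x =>
      Finset.prod_eq_zero (Finset.mem_univ i) (by simp [pairMatrix, hi])
    simp only [this, ite_self, integral_zero]
    split_ifs <;> positivity
  have hd' : ∀ i : Fin N, ¬ (s(w i.castSucc, w i.succ) : Sym2 (Fin n)).IsDiag := by simpa using hd
  set e : Fin N → Pair n := fun i => ⟨s(w i.castSucc, w i.succ), hd' i⟩ with he
  have h3 : ∀ x, walkWeight (pairMatrix g x) w = ∏ i, g (e i) (x (e i)) := fun x =>
    Finset.prod_congr rfl fun i _ => by
      simp only [pairMatrix, Matrix.of_apply]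
      rw [dif_pos (hd' i)]
  simp only [hw, if_true, h3]
  refine (le_abs_self _).trans ((abs_integral_prod_le ν h0 h1 h2 e).trans ?_)
  have h4 : (∀ i, ∃ j, j ≠ i ∧ e i = e j) ↔ IsGoodWalk w := by
    simp [IsGoodWalk, he, hw, hd]
  simp only [h4]
  split_ifs with hg
  · refine pow_le_pow_of_le_one hρ hρ1 ?_
    have h5 := card_image_le_card_edges_add_one w
    have h6 : (Finset.univ.image fun i : Fin N => s(w i.castSucc, w i.succ)) =
        (Finset.univ.image e).image Subtype.val := by
      rw [Finset.image_image]; rfl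
    rw [h6] at h5
    convert Nat.sub_le_of_le_add (h5.trans (Nat.add_le_add_right Finset.card_image_le 1))
  · exact le_rfl

end Moments

/-! ### Counting good walks by a random skew sign matrix -/

/-- The values of a centred variable (uniform on three points) all of whose moments of order at
least two are at least one. -/
def skewSign : Fin 3 → ℝ := ![-1, -1, 2]

/-- The skewness matters: for ±1 signs the odd moments vanish, yet a good walk may use an edge three
times. Here the third moment is positive, and only the first moment is zero. -/
theorem sum_skewSign_pow (c : ℕ) : ∑ t, skewSign t ^ c = 2 * (-1) ^ c + 2 ^ c := by
  simp [skewSign, Fin.sum_univ_three, two_mul]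

theorem sum_skewSign_pow_nonneg (c : ℕ) : 0 ≤ ∑ t, skewSign t ^ c := by
  rw [sum_skewSign_pow]
  rcases c with _ | c
  · norm_num
  · have : (1 : ℝ) ≤ 2 ^ c := one_le_pow₀ (by norm_num)
    rcases neg_one_pow_eq_or ℝ (c + 1) with h | h <;> rw [h, pow_succ] <;> linarith

theorem three_le_sum_skewSign_pow {c : ℕ} (hc : c ≠ 1) : 3 ≤ ∑ t, skewSign t ^ c := by
  rw [sum_skewSign_pow]
  rcases c with _ | _ | _ | c
  · norm_num
  · exact absurd rfl hc
  · norm_num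
  · have : (1 : ℝ) ≤ 2 ^ c := one_le_pow₀ (by norm_num)
    rcases neg_one_pow_eq_or ℝ (c + 1 + 1 + 1) with h | h <;> rw [h, pow_succ, pow_succ, pow_succ] <;>
      linarith

/-- The symmetric matrix with entries `skewSign (ω {i, j})`. -/
def skewSignMatrix {V : Type*} (ω : Sym2 V → Fin 3) : Matrix V V ℝ :=
  Matrix.of fun i j => skewSign (ω s(i, j))

theorem sum_prod_comp {E T R : Type*} [Fintype E] [DecidableEq E] [Fintype T] [CommSemiring R]
    (f : E → T → R) : ∑ ω : E → T, ∏ a, f a (ω a) = ∏ a, ∑ t, f a t := by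
  rw [Finset.prod_univ_sum, Fintype.piFinset_univ]

open Classical in
/-- The number of good closed walks is at most the average of the trace of a power of a random
sign matrix. -/
theorem card_good_walks_le {V : Type*} [Fintype V] [DecidableEq V] (N : ℕ) :
    ((Finset.univ.filter fun u : Fin (N + 1) → V => IsGoodWalk u).card : ℝ) *
      3 ^ Fintype.card (Sym2 V) ≤ ∑ ω : Sym2 V → Fin 3, (skewSignMatrix ω ^ N).trace := by
  simp_rw [trace_pow_eq_sum_walkWeight]
  rw [Finset.sum_comm, ← nsmul_eq_mul, ← Finset.sum_const, Finset.sum_filter]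
  refine Finset.sum_le_sum fun w _ => ?_
  by_cases hw : w 0 = w (Fin.last N)
  swap
  · simp [hw, IsGoodWalk]
  set e : Fin N → Sym2 V := fun i => s(w i.castSucc, w i.succ) with he
  have h1 : ∑ ω : Sym2 V → Fin 3, walkWeight (skewSignMatrix ω) w =
      ∏ a, ∑ t, skewSign t ^ (Finset.univ.filter fun i => e i = a).card := by
    rw [← sum_prod_comp]
    exact Finset.sum_congr rfl fun ω _ => prod_comp_eq_prod_pow_card e fun a => skewSign (ω a)
  simp only [hw, if_true]
  rw [h1]
  split_ifs with hg
  · rw [← Finset.card_univ, ← Finset.prod_const]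
    refine Finset.prod_le_prod (fun _ _ => by norm_num) fun a _ =>
      three_le_sum_skewSign_pow fun hc => ?_
    obtain ⟨i, hi⟩ := Finset.card_eq_one.1 hc
    have hia : e i = a := by
      have : i ∈ Finset.univ.filter fun i => e i = a := by rw [hi]; simp
      exact (Finset.mem_filter.1 this).2
    obtain ⟨j, hj, hij⟩ := hg.2.2 i
    have : j ∈ Finset.univ.filter fun i => e i = a := by
      simp only [Finset.mem_filter, Finset.mem_univ, true_and]
      rw [← hia]
      exact hij.symm
    rw [hi, Finset.mem_singleton] at this
    exact hj this
  -- Walks that are not good may be discarded because no moment is negative.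
  · exact Finset.prod_nonneg fun a _ => sum_skewSign_pow_nonneg _

/-! ### The spectral norm and traces -/

section OpNorm

variable {V : Type*} [Fintype V] [DecidableEq V]

theorem opNorm_nonneg (M : Matrix V V ℝ) : 0 ≤ opNorm M := norm_nonneg _

theorem opNorm_add_le (M M' : Matrix V V ℝ) : opNorm (M + M') ≤ opNorm M + opNorm M' := by
  rw [opNorm, map_add]; exact norm_add_le _ _

theorem opNorm_mul_le (M M' : Matrix V V ℝ) : opNorm (M * M') ≤ opNorm M * opNorm M' := by
  rw [opNorm, map_mul]; exact norm_mul_le _ _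

theorem opNorm_neg (M : Matrix V V ℝ) : opNorm (-M) = opNorm M := by
  rw [opNorm, map_neg, norm_neg]; rfl

theorem opNorm_smul (c : ℝ) (M : Matrix V V ℝ) : opNorm (c • M) = |c| * opNorm M := by
  rw [opNorm, map_smul, norm_smul, Real.norm_eq_abs]; rfl

theorem norm_toLp_mulVec_le (M : Matrix V V ℝ) (x : V → ℝ) :
    ‖WithLp.toLp 2 (M.mulVec x)‖ ≤ opNorm M * ‖WithLp.toLp 2 x‖ := by
  rw [← Matrix.toEuclideanCLM_toLp]; exact ContinuousLinearMap.le_opNorm _ _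

theorem opNorm_le_sqrt_sum_sq (M : Matrix V V ℝ) :
    opNorm M ≤ Real.sqrt (∑ i, ∑ j, M i j ^ 2) := by
  refine ContinuousLinearMap.opNorm_le_bound _ (Real.sqrt_nonneg _) fun x => ?_
  rw [EuclideanSpace.norm_eq, EuclideanSpace.norm_eq, ← Real.sqrt_mul (by positivity)]
  refine Real.sqrt_le_sqrt ?_
  rw [Finset.sum_mul]
  refine Finset.sum_le_sum fun i _ => ?_
  simp only [Real.norm_eq_abs, sq_abs, Matrix.ofLp_toEuclideanCLM, Matrix.mulVec, dotProduct]
  exact Finset.sum_mul_sq_le_sq_mul_sq _ _ _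

theorem opNorm_sq_le_sum_sq (M : Matrix V V ℝ) : opNorm M ^ 2 ≤ ∑ i, ∑ j, M i j ^ 2 := by
  calc opNorm M ^ 2 ≤ Real.sqrt (∑ i, ∑ j, M i j ^ 2) ^ 2 :=
        pow_le_pow_left₀ (opNorm_nonneg M) (opNorm_le_sqrt_sum_sq M) 2
    _ = _ := Real.sq_sqrt (by positivity)

theorem abs_apply_le_opNorm (M : Matrix V V ℝ) (i j : V) : |M i j| ≤ opNorm M := by
  have h := norm_toLp_mulVec_le M (Pi.single j 1)
  rw [PiLp.toLp_single, PiLp.norm_single, norm_one, mul_one,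
    Matrix.mulVec_single_one] at h
  exact (PiLp.norm_apply_le (WithLp.toLp 2 (M.col j)) i).trans h

theorem trace_pow_le (M : Matrix V V ℝ) {N : ℕ} (hN : 0 < N) :
    (M ^ N).trace ≤ Fintype.card V * opNorm M ^ N := by
  calc (M ^ N).trace ≤ ∑ _i : V, opNorm M ^ N := by
        refine Finset.sum_le_sum fun i _ => (le_abs_self _).trans ?_
        refine (abs_apply_le_opNorm (M ^ N) i i).trans ?_
        rw [opNorm, map_pow]
        exact norm_pow_le' _ hN
    _ = _ := by simp

/-- For self-adjoint operators, repeated squaring gives ‖M^(2^a)‖ = ‖M‖^(2^a); this is why exponents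
are powers of two. One more squaring bounds the norm by the Frobenius norm, whose square is the
trace of the next power. -/
theorem opNorm_pow_le_trace {M : Matrix V V ℝ} (hM : M.IsSymm) (a : ℕ) :
    opNorm M ^ (2 ^ (a + 1)) ≤ (M ^ (2 ^ (a + 1))).trace := by
  have hs : IsSelfAdjoint (Matrix.toEuclideanCLM (𝕜 := ℝ) M) := by
    rw [IsSelfAdjoint, ← map_star]
    congr 1
  have h1 : opNorm M ^ (2 ^ a) = opNorm (M ^ (2 ^ a)) := by
    rw [opNorm, opNorm, map_pow, hs.norm_pow_two_pow]
  have h2 : (M ^ (2 ^ a)).IsSymm := hM.pow _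
  rw [pow_succ, pow_mul, pow_mul, h1]
  refine (opNorm_sq_le_sum_sq _).trans_eq ?_
  rw [pow_two, Matrix.trace]
  refine Finset.sum_congr rfl fun i _ => ?_
  rw [Matrix.diag_apply, Matrix.mul_apply]
  exact Finset.sum_congr rfl fun j _ => by rw [h2.apply i j, pow_two]

end OpNorm

/-! ### Nets of the Euclidean ball -/

section Net

/-- Rounding towards zero does not increase absolute values, so net points stay in the unit ball. -/
theorem exists_int_round (t : ℝ) : ∃ z : ℤ, |t - z| ≤ 1 ∧ |(z : ℝ)| ≤ |t| := by
  rcases le_total 0 t with h | h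
  · have h0 : (0 : ℝ) ≤ ⌊t⌋ := by exact_mod_cast Int.floor_nonneg.2 h
    refine ⟨⌊t⌋, ?_, ?_⟩
    · rw [abs_le]; constructor <;> linarith [Int.floor_le t, Int.lt_floor_add_one t]
    · rw [abs_of_nonneg h0, abs_of_nonneg h]; exact Int.floor_le t
  · have h0 : (⌈t⌉ : ℝ) ≤ 0 := by exact_mod_cast Int.ceil_le.2 (by simpa using h)
    refine ⟨⌈t⌉, ?_, ?_⟩
    · rw [abs_le]; constructor <;> linarith [Int.le_ceil t, Int.ceil_lt_add_one t]
    · rw [abs_of_nonpos h0, abs_of_nonpos h]; linarith [Int.le_ceil t]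

theorem sum_Icc_half_pow_natAbs_le (K : ℕ) :
    ∑ z ∈ Finset.Icc (-K : ℤ) K, (1 / 2 : ℝ) ^ z.natAbs ≤ 3 - 2 * (1 / 2) ^ K := by
  induction K with
  | zero => norm_num
  | succ K ih =>
    have h : Finset.Icc (-(K + 1 : ℕ) : ℤ) (K + 1 : ℕ) =
        insert (-(K + 1 : ℕ) : ℤ) (insert ((K + 1 : ℕ) : ℤ) (Finset.Icc (-K : ℤ) K)) := by
      ext z
      simp only [Finset.mem_Icc, Finset.mem_insert]
      omega
    rw [h, Finset.sum_insert, Finset.sum_insert, Int.natAbs_neg, Int.natAbs_natCast, pow_succ]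
    · linarith
    · simp
    · simp only [Finset.mem_Icc, Finset.mem_insert]
      omega

/-- The number of integer vectors of small `ℓ¹` norm. -/
theorem card_int_vectors_le (r K : ℕ) :
    ((Fintype.piFinset fun _ : Fin r => Finset.Icc (-K : ℤ) K).filter
      fun z => ∑ i, (z i).natAbs ≤ K).card ≤ (2 ^ K * 3 ^ r : ℝ) := by
  rw [Finset.card_eq_sum_ones, Nat.cast_sum, Finset.sum_filter]
  calc ∑ z ∈ Fintype.piFinset fun _ : Fin r => Finset.Icc (-K : ℤ) K,
        (if ∑ i, (z i).natAbs ≤ K then ((1 : ℕ) : ℝ) else 0)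
      ≤ ∑ z ∈ Fintype.piFinset fun _ : Fin r => Finset.Icc (-K : ℤ) K,
          -- The weight 2^(K − ‖z‖₁) is at least 1 on the vectors counted, and it factors over
          -- coordinates.
          2 ^ K * ∏ i, (1 / 2 : ℝ) ^ (z i).natAbs := by
        refine Finset.sum_le_sum fun z _ => ?_
        split_ifs with h
        · rw [Finset.prod_pow_eq_pow_sum]
          calc ((1 : ℕ) : ℝ) = 2 ^ K * (1 / 2) ^ K := by rw [← mul_pow]; norm_num
            _ ≤ _ := mul_le_mul_of_nonneg_left
              (pow_le_pow_of_le_one (by norm_num) (by norm_num) h) (by positivity)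
        · positivity
    _ = 2 ^ K * ∏ _i : Fin r, ∑ z ∈ Finset.Icc (-K : ℤ) K, (1 / 2 : ℝ) ^ z.natAbs := by
        rw [Finset.prod_univ_sum, Finset.mul_sum]
    _ ≤ 2 ^ K * ∏ _i : Fin r, 3 := by
        gcongr
        refine (sum_Icc_half_pow_natAbs_le K).trans ?_
        have : (0 : ℝ) ≤ (1 / 2) ^ K := by positivity
        linarith
    _ = _ := by simp

/-- A net of the Euclidean unit ball of exponential size. -/
theorem exists_net (r : ℕ) : ∃ S : Finset (EuclideanSpace ℝ (Fin r)),
    (S.card : ℝ) ≤ 48 ^ r ∧ (∀ x ∈ S, ‖x‖ ≤ 1) ∧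
      ∀ x : EuclideanSpace ℝ (Fin r), ‖x‖ ≤ 1 → ∃ y ∈ S, ‖x - y‖ ≤ 1 / 4 := by
  classical
  -- The mesh of the grid: an error of `c` per coordinate gives c√r = 1/4 in norm. Rounded points
  -- have integer ℓ¹ norm at most 4r, whence 2^(4r)·3^r = 48^r.
  set c : ℝ := (4 * Real.sqrt r)⁻¹ with hc
  set Z := (Fintype.piFinset fun _ : Fin r => Finset.Icc (-(4 * r : ℕ) : ℤ) (4 * r : ℕ)).filter
      fun z => ∑ i, (z i).natAbs ≤ 4 * r with hZ
  let F : (Fin r → ℤ) → EuclideanSpace ℝ (Fin r) := fun z => WithLp.toLp 2 fun i => c * z i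
  refine ⟨(Z.image F).filter fun y => ‖y‖ ≤ 1, ?_, fun x hx => (Finset.mem_filter.1 hx).2, ?_⟩
  · calc (((Z.image F).filter fun y => ‖y‖ ≤ 1).card : ℝ) ≤ Z.card := by
          exact_mod_cast (Finset.card_filter_le _ _).trans Finset.card_image_le
      _ ≤ 2 ^ (4 * r) * 3 ^ r := card_int_vectors_le r (4 * r)
      _ = 48 ^ r := by rw [pow_mul, ← mul_pow]; norm_num
  · intro x hx
    rcases Nat.eq_zero_or_pos r with rfl | hr
    · refine ⟨F 0, ?_, ?_⟩
      · refine Finset.mem_filter.2 ⟨Finset.mem_image_of_mem _ ?_, ?_⟩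
        · exact Finset.mem_filter.2 ⟨Fintype.mem_piFinset.2 fun i => i.elim0, by simp⟩
        · rw [Subsingleton.elim (F 0) 0]; simp
      · rw [Subsingleton.elim (x - F 0) 0]; simp
    have hsr : 0 < Real.sqrt r := Real.sqrt_pos.2 (by exact_mod_cast hr)
    have hc0 : 0 < c := by positivity
    choose z hz1 hz2 using fun i => exists_int_round (c⁻¹ * x i)
    have hle : ∀ i, |F z i| ≤ |x i| := fun i => by
      have := mul_le_mul_of_nonneg_left (hz2 i) hc0.le
      rw [abs_mul, abs_of_pos (inv_pos.2 hc0), mul_inv_cancel_left₀ hc0.ne'] at this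
      change |c * z i| ≤ _
      rwa [abs_mul, abs_of_pos hc0]
    have hsq : ∑ i, x i ^ 2 ≤ 1 := by
      have := pow_le_one₀ (n := 2) (norm_nonneg x) hx
      rwa [EuclideanSpace.norm_sq_eq, Finset.sum_congr rfl fun i _ => by
        rw [Real.norm_eq_abs, sq_abs]] at this
    have hnorm : ‖F z‖ ≤ 1 := by
      rw [EuclideanSpace.norm_eq]
      refine Real.sqrt_le_one.2 (le_trans (Finset.sum_le_sum fun i _ => ?_) hsq)
      rw [Real.norm_eq_abs, sq_abs]
      exact sq_le_sq.2 (hle i)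
    have hsum : ∑ i, (z i).natAbs ≤ 4 * r := by
      have h1 : ∑ i, |x i| ≤ Real.sqrt r := by
        refine Real.le_sqrt_of_sq_le ?_
        have := sq_sum_le_card_mul_sum_sq (s := Finset.univ) (f := fun i => |x i|)
        simp only [sq_abs, Finset.card_univ, Fintype.card_fin] at this
        nlinarith [(Nat.cast_nonneg r : (0 : ℝ) ≤ r)]
      have h2 : ∑ i, |(z i : ℝ)| ≤ 4 * r := by
        calc ∑ i, |(z i : ℝ)| ≤ ∑ i, c⁻¹ * |x i| := Finset.sum_le_sum fun i _ => by
              simpa [abs_mul, abs_of_pos hc0] using hz2 i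
          _ = 4 * Real.sqrt r * ∑ i, |x i| := by rw [← Finset.mul_sum, hc, inv_inv]
          _ ≤ 4 * Real.sqrt r * Real.sqrt r := by gcongr
          _ = 4 * r := by rw [mul_assoc, Real.mul_self_sqrt (by positivity)]
      have h3 : ((∑ i, (z i).natAbs : ℕ) : ℝ) = ∑ i, |(z i : ℝ)| := by
        push_cast
        exact Finset.sum_congr rfl fun i _ => by rw [Nat.cast_natAbs, Int.cast_abs]
      rw [← h3] at h2
      exact_mod_cast h2
    refine ⟨F z, Finset.mem_filter.2 ⟨Finset.mem_image_of_mem _ ?_, hnorm⟩, ?_⟩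
    · refine Finset.mem_filter.2 ⟨Fintype.mem_piFinset.2 fun i => ?_, hsum⟩
      have := (Finset.single_le_sum (fun j _ => Nat.zero_le _) (Finset.mem_univ i)).trans hsum
      rw [Finset.mem_Icc]
      omega
    · rw [EuclideanSpace.norm_eq]
      refine Real.sqrt_le_iff.2 ⟨by norm_num, ?_⟩
      calc ∑ i, ‖(x - F z) i‖ ^ 2 ≤ ∑ _i : Fin r, c ^ 2 := by
            refine Finset.sum_le_sum fun i _ => ?_
            rw [Real.norm_eq_abs]
            refine pow_le_pow_left₀ (abs_nonneg _) ?_ 2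
            have h1 : (x - F z) i = c * (c⁻¹ * x i - z i) := by
              rw [mul_sub, mul_inv_cancel_left₀ hc0.ne']; rfl
            rw [h1, abs_mul, abs_of_pos hc0]
            exact mul_le_of_le_one_right hc0.le (hz1 i)
        _ = (1 / 4) ^ 2 := by
            have h2 : Real.sqrt r ^ 2 = r := Real.sq_sqrt (by positivity)
            have h3 : (r : ℝ) ≠ 0 := by exact_mod_cast hr.ne'
            rw [Finset.sum_const, Finset.card_univ, Fintype.card_fin, nsmul_eq_mul, hc, inv_pow,
              mul_pow, h2]
            field_simp

/-- Replacing each of the two unit vectors by a net point costs ‖T‖/4, so ‖T‖ ≤ K + ‖T‖/2. -/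
theorem norm_le_two_mul_of_net {E : Type*} [NormedAddCommGroup E] [InnerProductSpace ℝ E]
    {S : Finset E} (hS : ∀ x ∈ S, ‖x‖ ≤ 1) (hnet : ∀ x : E, ‖x‖ ≤ 1 → ∃ y ∈ S, ‖x - y‖ ≤ 1 / 4)
    (T : E →L[ℝ] E) {K : ℝ} (hK : 0 ≤ K) (h : ∀ x ∈ S, ∀ y ∈ S, |inner ℝ x (T y)| ≤ K) :
    ‖T‖ ≤ 2 * K := by
  have key : ∀ x y : E, ‖x‖ ≤ 1 → ‖y‖ ≤ 1 → inner ℝ x (T y) ≤ K + ‖T‖ / 2 := by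
    intro x y hx hy
    obtain ⟨x', hx', hxx⟩ := hnet x hx
    obtain ⟨y', hy', hyy⟩ := hnet y hy
    have h1 : inner ℝ x (T y) = inner ℝ (x - x') (T y) + inner ℝ x' (T (y - y')) +
        inner ℝ x' (T y') := by
      rw [inner_sub_left, map_sub, inner_sub_right]; ring
    have h2 : inner ℝ (x - x') (T y) ≤ 1 / 4 * (‖T‖ * 1) :=
      (real_inner_le_norm _ _).trans (mul_le_mul hxx
        ((T.le_opNorm y).trans (by gcongr)) (norm_nonneg _) (by norm_num))
    have h3 : inner ℝ x' (T (y - y')) ≤ 1 * (‖T‖ * (1 / 4)) :=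
      (real_inner_le_norm _ _).trans (mul_le_mul (hS x' hx')
        ((T.le_opNorm _).trans (by gcongr)) (norm_nonneg _) (by norm_num))
    have h4 := (le_abs_self _).trans (h x' hx' y' hy')
    linarith
  have h5 : ‖T‖ ≤ K + ‖T‖ / 2 := by
    refine ContinuousLinearMap.opNorm_le_of_unit_norm (by positivity) fun y hy => ?_
    by_cases h0 : T y = 0
    · rw [h0, norm_zero]; positivity
    have h6 : 0 < ‖T y‖ := norm_pos_iff.2 h0
    have h7 := key (‖T y‖⁻¹ • T y) y (by
      rw [norm_smul, norm_inv, norm_norm, inv_mul_cancel₀ h6.ne']) hy.le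
    rwa [real_inner_smul_left, real_inner_self_eq_norm_sq, pow_two,
      inv_mul_cancel_left₀ h6.ne'] at h7
  linarith

end Net

/-! ### Subgaussian moments and the count of good walks -/

/-- The linear term cancels when averaged over a centred variable, leaving a subgaussian bound. -/
theorem exp_le_add_exp_sq (x : ℝ) : Real.exp x ≤ x + Real.exp (x ^ 2) := by
  have h1 : x ^ 2 + 1 ≤ Real.exp (x ^ 2) := Real.add_one_le_exp _
  rcases le_total |x| 1 with h | h
  · have := (abs_le.1 (Real.abs_exp_sub_one_sub_id_le h)).2
    linarith
  · rcases abs_cases x with ⟨h2, h3⟩ | ⟨h2, h3⟩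
    · have : Real.exp x ≤ Real.exp (x ^ 2) := Real.exp_le_exp.2 (by nlinarith)
      linarith
    · have : Real.exp x ≤ 1 := Real.exp_le_one_iff.2 h3.le
      nlinarith

theorem sum_exp_mul_skewSign_le (a : ℝ) :
    ∑ t, Real.exp (a * skewSign t) ≤ 3 * Real.exp (4 * a ^ 2) := by
  have h1 := exp_le_add_exp_sq (a * (-1))
  have h2 := exp_le_add_exp_sq (a * 2)
  have h3 : Real.exp ((a * (-1)) ^ 2) ≤ Real.exp (4 * a ^ 2) :=
    Real.exp_le_exp.2 (by nlinarith [sq_nonneg a])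
  have h4 : (a * 2) ^ 2 = 4 * a ^ 2 := by ring
  rw [h4] at h2
  simp only [skewSign, Fin.sum_univ_three, Matrix.cons_val_zero, Matrix.cons_val_one,
    Matrix.cons_val]
  linarith

theorem sum_exp_sum_mul_skewSign_le {E : Type*} [Fintype E] [DecidableEq E] (c : E → ℝ) (l : ℝ) :
    ∑ ω : E → Fin 3, Real.exp (l * ∑ a, c a * skewSign (ω a)) ≤
      3 ^ Fintype.card E * Real.exp (4 * l ^ 2 * ∑ a, c a ^ 2) := by
  calc ∑ ω : E → Fin 3, Real.exp (l * ∑ a, c a * skewSign (ω a))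
      = ∑ ω : E → Fin 3, ∏ a, Real.exp (l * c a * skewSign (ω a)) := by
        refine Finset.sum_congr rfl fun ω _ => ?_
        rw [← Real.exp_sum, Finset.mul_sum]
        simp_rw [mul_assoc]
    _ = ∏ a, ∑ t, Real.exp (l * c a * skewSign t) :=
        sum_prod_comp fun a t => Real.exp (l * c a * skewSign t)
    _ ≤ ∏ a, 3 * Real.exp (4 * (l * c a) ^ 2) :=
        Finset.prod_le_prod (fun _ _ => Finset.sum_nonneg fun _ _ => (Real.exp_pos _).le)
          fun a _ => sum_exp_mul_skewSign_le _
    _ = _ := by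
        rw [Finset.prod_mul_distrib, Finset.prod_const, ← Real.exp_sum, Finset.mul_sum,
          Finset.card_univ]
        congr 2
        exact Finset.sum_congr rfl fun a _ => by ring

/-- Moments of a weighted sum of independent skew signs. -/
theorem sum_abs_pow_skewSign_le {E : Type*} [Fintype E] [DecidableEq E] (c : E → ℝ) {N : ℕ}
    (hN : 0 < N) (hc : ∑ a, c a ^ 2 ≤ 2) :
    ∑ ω : E → Fin 3, |∑ a, c a * skewSign (ω a)| ^ N ≤
      3 ^ Fintype.card E * (2 * (Real.exp 8 * Real.sqrt N) ^ N) := by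
  set l := Real.sqrt N with hl
  have hN' : (0 : ℝ) < N := by exact_mod_cast hN
  have hl0 : 0 < l := Real.sqrt_pos.2 hN'
  have hl2 : l ^ 2 = N := Real.sq_sqrt hN'.le
  -- From (l|z|)^N / N! ≤ exp(l|z|) and N! ≤ N^N = l^(2N). With l = √N the exponential moments are
  -- at most exp(4l²·2) = exp(8)^N.
  have hpt : ∀ z : ℝ, |z| ^ N ≤ l ^ N * (Real.exp (l * z) + Real.exp (-l * z)) := by
    intro z
    have h1 := Real.pow_div_factorial_le_exp (l * |z|) (by positivity) N
    rw [div_le_iff₀ (by positivity)] at h1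
    have h2 : (N.factorial : ℝ) ≤ l ^ N * l ^ N := by
      rw [← mul_pow, ← pow_two, hl2]
      exact_mod_cast Nat.factorial_le_pow N
    have h3 : Real.exp (l * |z|) ≤ Real.exp (l * z) + Real.exp (-l * z) := by
      rcases abs_cases z with ⟨h, -⟩ | ⟨h, -⟩ <;> rw [h]
      · linarith [Real.exp_pos (-l * z)]
      · rw [mul_neg, neg_mul]; linarith [Real.exp_pos (l * z)]
    have h4 : l ^ N * |z| ^ N ≤ l ^ N * (l ^ N * (Real.exp (l * z) + Real.exp (-l * z))) := by
      calc l ^ N * |z| ^ N = (l * |z|) ^ N := (mul_pow _ _ _).symm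
        _ ≤ Real.exp (l * |z|) * N.factorial := h1
        _ ≤ (Real.exp (l * z) + Real.exp (-l * z)) * (l ^ N * l ^ N) := by gcongr
        _ = _ := by ring
    exact le_of_mul_le_mul_left h4 (by positivity)
  have hexp : ∀ l' : ℝ, l' ^ 2 = N → ∑ ω : E → Fin 3, Real.exp (l' * ∑ a, c a * skewSign (ω a)) ≤
      3 ^ Fintype.card E * Real.exp 8 ^ N := by
    intro l' hl'
    refine (sum_exp_sum_mul_skewSign_le c l').trans ?_
    rw [hl', ← Real.exp_nat_mul]
    exact mul_le_mul_of_nonneg_left (Real.exp_le_exp.2 (by nlinarith)) (by positivity)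
  calc ∑ ω : E → Fin 3, |∑ a, c a * skewSign (ω a)| ^ N
      ≤ ∑ ω : E → Fin 3, l ^ N * (Real.exp (l * ∑ a, c a * skewSign (ω a)) +
          Real.exp (-l * ∑ a, c a * skewSign (ω a))) := Finset.sum_le_sum fun ω _ => hpt _
    _ = l ^ N * (∑ ω : E → Fin 3, Real.exp (l * ∑ a, c a * skewSign (ω a)) +
          ∑ ω : E → Fin 3, Real.exp (-l * ∑ a, c a * skewSign (ω a))) := by
        rw [← Finset.mul_sum, Finset.sum_add_distrib]
    _ ≤ l ^ N * (3 ^ Fintype.card E * Real.exp 8 ^ N + 3 ^ Fintype.card E * Real.exp 8 ^ N) := by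
        gcongr
        · exact hexp l hl2
        · exact hexp (-l) (by rw [neg_sq, hl2])
    _ = _ := by rw [mul_pow]; ring

theorem card_filter_mk_eq_le_two {V : Type*} [Fintype V] [DecidableEq V] (a : Sym2 V) :
    (Finset.univ.filter fun p : V × V => s(p.1, p.2) = a).card ≤ 2 := by
  induction a using Sym2.ind with
  | _ i j =>
    refine (Finset.card_le_card (t := {(i, j), (j, i)}) fun p hp => ?_).trans Finset.card_le_two
    have := Sym2.eq_iff.1 (Finset.mem_filter.1 hp).2
    simp only [Finset.mem_insert, Finset.mem_singleton, Prod.ext_iff]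
    tauto

/-- The bilinear form is linear in the independent signs. Each unordered pair collects at most two
ordered ones, so the squared coefficients sum to at most 2‖x‖²‖y‖². -/
theorem sum_abs_inner_skewSignMatrix_pow_le {V : Type*} [Fintype V] [DecidableEq V]
    {x y : EuclideanSpace ℝ V} (hx : ‖x‖ ≤ 1) (hy : ‖y‖ ≤ 1) {N : ℕ} (hN : 0 < N) :
    ∑ ω : Sym2 V → Fin 3,
        |inner ℝ x (Matrix.toEuclideanCLM (𝕜 := ℝ) (skewSignMatrix ω) y)| ^ N ≤
      3 ^ Fintype.card (Sym2 V) * (2 * (Real.exp 8 * Real.sqrt N) ^ N) := by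
  have hsq : ∀ z : EuclideanSpace ℝ V, ‖z‖ ≤ 1 → ∑ i, z i ^ 2 ≤ 1 := fun z hz => by
    have := pow_le_one₀ (n := 2) (norm_nonneg z) hz
    rwa [EuclideanSpace.norm_sq_eq, Finset.sum_congr rfl fun i _ => by
      rw [Real.norm_eq_abs, sq_abs]] at this
  set c : Sym2 V → ℝ := fun a => ∑ p : V × V with s(p.1, p.2) = a, x p.1 * y p.2 with hc
  have h1 : ∀ ω : Sym2 V → Fin 3,
      inner ℝ x (Matrix.toEuclideanCLM (𝕜 := ℝ) (skewSignMatrix ω) y) =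
        ∑ a, c a * skewSign (ω a) := by
    intro ω
    rw [Matrix.inner_toEuclideanCLM]
    calc x.ofLp ⬝ᵥ (skewSignMatrix ω).mulVec y.ofLp
        = ∑ p : V × V, x p.1 * y p.2 * skewSign (ω s(p.1, p.2)) := by
          simp only [dotProduct, Matrix.mulVec, skewSignMatrix, Matrix.of_apply, Finset.mul_sum,
            Fintype.sum_prod_type]
          exact Finset.sum_congr rfl fun i _ => Finset.sum_congr rfl fun j _ => by ring
      _ = ∑ a, ∑ p : V × V with s(p.1, p.2) = a, x p.1 * y p.2 * skewSign (ω s(p.1, p.2)) :=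
          (Finset.sum_fiberwise _ _ _).symm
      _ = _ := by
          refine Finset.sum_congr rfl fun a _ => ?_
          rw [hc, Finset.sum_mul]
          exact Finset.sum_congr rfl fun p hp => by rw [(Finset.mem_filter.1 hp).2]
  simp_rw [h1]
  refine sum_abs_pow_skewSign_le c hN ?_
  calc ∑ a, c a ^ 2
      ≤ ∑ a, 2 * ∑ p : V × V with s(p.1, p.2) = a, (x p.1 * y p.2) ^ 2 := by
        refine Finset.sum_le_sum fun a _ => (sq_sum_le_card_mul_sum_sq).trans ?_
        gcongr
        exact_mod_cast card_filter_mk_eq_le_two a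
    _ = 2 * ((∑ i, x i ^ 2) * ∑ j, y j ^ 2) := by
        rw [← Finset.mul_sum, Finset.sum_fiberwise, Fintype.sum_prod_type, Finset.sum_mul_sum]
        simp_rw [mul_pow]
    _ ≤ 2 * (1 * 1) := by
        gcongr
        · exact hsq x hx
        · exact hsq y hy
    _ = 2 := by norm_num

/-- The maximum over the net is replaced by a sum, which can be averaged term by term. -/
theorem norm_pow_le_sum_of_net {E : Type*} [NormedAddCommGroup E] [InnerProductSpace ℝ E]
    {S : Finset E} (hS : ∀ x ∈ S, ‖x‖ ≤ 1) (hnet : ∀ x : E, ‖x‖ ≤ 1 → ∃ y ∈ S, ‖x - y‖ ≤ 1 / 4)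
    (T : E →L[ℝ] E) {N : ℕ} (hN : 0 < N) :
    ‖T‖ ^ N ≤ ∑ p ∈ S ×ˢ S, 2 ^ N * |inner ℝ p.1 (T p.2)| ^ N := by
  set f : E × E → ℝ := fun p => |inner ℝ p.1 (T p.2)| ^ N with hf
  have hf0 : ∀ p, 0 ≤ f p := fun p => by positivity
  set B := ∑ p ∈ S ×ˢ S, f p with hB
  have hB0 : 0 ≤ B := Finset.sum_nonneg fun p _ => hf0 p
  rw [← Finset.mul_sum]
  have h1 : ‖T‖ ≤ 2 * B ^ ((N : ℝ)⁻¹) := by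
    refine norm_le_two_mul_of_net hS hnet T (by positivity) fun x hx y hy => ?_
    refine (pow_le_pow_iff_left₀ (abs_nonneg _) (by positivity) hN.ne').1 ?_
    rw [Real.rpow_inv_natCast_pow hB0 hN.ne']
    exact Finset.single_le_sum (f := f) (fun p _ => hf0 p) (Finset.mk_mem_product hx hy)
  calc ‖T‖ ^ N ≤ (2 * B ^ ((N : ℝ)⁻¹)) ^ N := pow_le_pow_left₀ (norm_nonneg _) h1 N
    _ = 2 ^ N * B := by rw [mul_pow, Real.rpow_inv_natCast_pow hB0 hN.ne']

open Classical in
/-- The number of good closed walks of length `N` in `[r]`. -/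
theorem card_good_walks_fin_le {r N : ℕ} (hN : 0 < N) :
    ((Finset.univ.filter fun u : Fin (N + 1) → Fin r => IsGoodWalk u).card : ℝ) ≤
      r * 48 ^ (2 * r) * (2 * (2 * Real.exp 8 * Real.sqrt N) ^ N) := by
  obtain ⟨S, hS, hS1, hnet⟩ := exists_net r
  set E := Fintype.card (Sym2 (Fin r))
  let T := fun ω : Sym2 (Fin r) → Fin 3 => Matrix.toEuclideanCLM (𝕜 := ℝ) (skewSignMatrix ω)
  have hop : ∀ ω, opNorm (skewSignMatrix ω) ^ N ≤
      ∑ p ∈ S ×ˢ S, 2 ^ N * |inner ℝ p.1 (T ω p.2)| ^ N :=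
    fun ω => norm_pow_le_sum_of_net hS1 hnet (T ω) hN
  have h3 : (0 : ℝ) < 3 ^ E := by positivity
  refine le_of_mul_le_mul_right ((card_good_walks_le N).trans ?_) h3
  calc ∑ ω : Sym2 (Fin r) → Fin 3, (skewSignMatrix ω ^ N).trace
      ≤ ∑ ω : Sym2 (Fin r) → Fin 3, r * ∑ p ∈ S ×ˢ S, 2 ^ N * |inner ℝ p.1 (T ω p.2)| ^ N := by
        refine Finset.sum_le_sum fun ω _ => (trace_pow_le _ hN).trans ?_
        rw [Fintype.card_fin]
        exact mul_le_mul_of_nonneg_left (hop ω) (by positivity)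
    _ = r * ∑ p ∈ S ×ˢ S, 2 ^ N * ∑ ω : Sym2 (Fin r) → Fin 3, |inner ℝ p.1 (T ω p.2)| ^ N := by
        rw [← Finset.mul_sum, Finset.sum_comm]
        simp_rw [Finset.mul_sum]
    _ ≤ r * ∑ p ∈ S ×ˢ S, 2 ^ N * (3 ^ E * (2 * (Real.exp 8 * Real.sqrt N) ^ N)) := by
        gcongr with p hp
        obtain ⟨h1, h2⟩ := Finset.mem_product.1 hp
        exact sum_abs_inner_skewSignMatrix_pow_le (hS1 _ h1) (hS1 _ h2) hN
    _ = r * (S.card * S.card : ℝ) * (2 ^ N * (3 ^ E * (2 * (Real.exp 8 * Real.sqrt N) ^ N))) := by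
        rw [Finset.sum_const, Finset.card_product, nsmul_eq_mul]
        push_cast
        ring
    _ ≤ r * (48 ^ r * 48 ^ r) * (2 ^ N * (3 ^ E * (2 * (Real.exp 8 * Real.sqrt N) ^ N))) := by
        gcongr
    _ = _ := by
        rw [two_mul r, pow_add, mul_assoc 2, mul_pow 2]
        ring

/-! ### Norm tail without logarithmic loss -/

section Tail

variable {Ω : Type*} [Finite Ω] [MeasurableSpace Ω] [MeasurableSingletonClass Ω]

/-- Compression goes to 2N vertices: the requirement nρ ≤ 2N − N is `hN`. The two nets then cost
48^(4N), which is absorbed into the base of the N-th power. -/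
theorem integral_opNorm_pairMatrix_pow_le {n a : ℕ} (ν : Pair n → Measure Ω)
    [∀ e, IsProbabilityMeasure (ν e)] {g : Pair n → Ω → ℝ} {ρ : ℝ} (hρ : 0 ≤ ρ) (hρ1 : ρ ≤ 1)
    (h0 : ∀ e, ∫ x, g e x ∂(ν e) = 0) (h1 : ∀ e x, |g e x| ≤ 1)
    (h2 : ∀ e, ∫ x, g e x ^ 2 ∂(ν e) ≤ ρ) (hN : n * ρ ≤ (2 ^ (a + 1) : ℕ)) :
    ∫ x, opNorm (pairMatrix g x) ^ 2 ^ (a + 1) ∂(Measure.pi ν) ≤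
      n * (8 * 48 ^ 4 * Real.exp 8 * Real.sqrt (2 ^ (a + 1) : ℕ)) ^ 2 ^ (a + 1) := by
  classical
  set N := 2 ^ (a + 1) with hNdef
  have hNpos : 0 < N := by positivity
  -- Absorbs the remaining polynomial factor 4N into the N-th power as well.
  have h4 : ((2 * N : ℕ) : ℝ) * 2 ≤ 4 ^ N := by
    have : 2 * N * 2 ≤ 4 ^ N := by
      have h5 : N < 2 ^ N := Nat.lt_two_pow_self
      have h6 : 2 ≤ 2 ^ a * 2 := by have := Nat.one_le_two_pow (n := a); omega
      obtain ⟨m, hm⟩ : ∃ m, N = m + 1 := ⟨N - 1, by omega⟩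
      have h7 : m < 2 ^ m := Nat.lt_two_pow_self
      have h8 : 4 ^ m = 2 ^ m * 2 ^ m := by rw [← mul_pow]; norm_num
      rw [hm, pow_succ 4, h8]
      nlinarith
    exact_mod_cast this
  calc ∫ x, opNorm (pairMatrix g x) ^ N ∂(Measure.pi ν)
      ≤ ∫ x, (pairMatrix g x ^ N).trace ∂(Measure.pi ν) :=
        integral_mono Integrable.of_finite Integrable.of_finite fun x =>
          opNorm_pow_le_trace (pairMatrix_isSymm g x) a
    _ ≤ ∑ w : Fin (N + 1) → Fin n with IsGoodWalk w, ρ ^ ((Finset.univ.image w).card - 1) :=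
        integral_trace_pow_le ν hρ hρ1 h0 h1 h2
    _ ≤ n * (Finset.univ.filter fun u : Fin (N + 1) → Fin (2 * N) => IsGoodWalk u).card := by
        have := sum_good_walks_le (α := Fin n) (β := Fin (2 * N)) N hρ (by simp; omega)
          (by simp only [Fintype.card_fin]; push_cast at hN ⊢; linarith)
        rw [Fintype.card_fin] at this
        convert this
    _ ≤ n * ((2 * N : ℕ) * 48 ^ (2 * (2 * N)) * (2 * (2 * Real.exp 8 * Real.sqrt N) ^ N)) := by
        gcongr
        exact card_good_walks_fin_le hNpos
    _ = n * ((((2 * N : ℕ) : ℝ) * 2) * ((48 ^ 4) ^ N * (2 * Real.exp 8 * Real.sqrt N) ^ N)) := by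
        rw [← pow_mul]
        ring
    _ ≤ n * (4 ^ N * ((48 ^ 4) ^ N * (2 * Real.exp 8 * Real.sqrt N) ^ N)) := by gcongr
    _ = _ := by
        rw [← mul_pow, ← mul_pow]
        ring_nf

/-- Sharp norm bound for symmetric random matrices with independent centred entries of variance at
most `ρ`, in the regime `1 ≤ n * ρ`. -/
theorem exists_opNorm_pairMatrix_tail :
    ∃ C : ℝ, 0 < C ∧ ∀ {n : ℕ} (ν : Pair n → Measure Ω) [∀ e, IsProbabilityMeasure (ν e)]
      (g : Pair n → Ω → ℝ) (ρ : ℝ), 0 ≤ ρ → ρ ≤ 1 → 1 ≤ n * ρ →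
      (∀ e, ∫ x, g e x ∂(ν e) = 0) → (∀ e x, |g e x| ≤ 1) →
      (∀ e, ∫ x, g e x ^ 2 ∂(ν e) ≤ ρ) →
      (Measure.pi ν).real {x | C * Real.sqrt (n * ρ) < opNorm (pairMatrix g x)} ≤
        n * Real.exp (-(n * ρ) / 2) := by
  set C₁ : ℝ := 8 * 48 ^ 4 * Real.exp 8 with hC₁
  have hC₁0 : 0 < C₁ := by positivity
  refine ⟨4 * C₁, by positivity, fun {n} ν _ g ρ hρ hρ1 hnρ h0 h1 h2 => ?_⟩
  -- The exponent N is the power of two with N/2 ≤ nρ < N.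
  obtain ⟨a, ha1, ha2⟩ := exists_nat_pow_near hnρ (one_lt_two : (1 : ℝ) < 2)
  set N := 2 ^ (a + 1) with hN
  have hNc : (N : ℝ) = 2 ^ (a + 1) := by rw [hN]; push_cast; rfl
  have hNpos : (0 : ℝ) < N := by rw [hNc]; positivity
  have hsN : Real.sqrt N ≤ 2 * Real.sqrt (n * ρ) := by
    refine Real.sqrt_le_iff.2 ⟨by positivity, ?_⟩
    rw [mul_pow, Real.sq_sqrt (by positivity), hNc, pow_succ]
    linarith
  have hs0 : 0 < Real.sqrt N := Real.sqrt_pos.2 hNpos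
  have hint := integral_opNorm_pairMatrix_pow_le ν hρ hρ1 h0 h1 h2 (a := a)
    (by push_cast; exact ha2.le)
  rw [← hN] at hint
  have hmk := mul_meas_ge_le_integral_of_nonneg (μ := Measure.pi ν)
    (f := fun x => opNorm (pairMatrix g x) ^ N)
    (ae_of_all _ fun x => pow_nonneg (opNorm_nonneg _) N) Integrable.of_finite
    ((2 * (C₁ * Real.sqrt N)) ^ N)
  have hsub : (Measure.pi ν).real {x | 4 * C₁ * Real.sqrt (n * ρ) < opNorm (pairMatrix g x)} ≤
      (Measure.pi ν).real {x | (2 * (C₁ * Real.sqrt N)) ^ N ≤ opNorm (pairMatrix g x) ^ N} := by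
    refine measureReal_mono fun x hx => ?_
    have hx' : 4 * C₁ * Real.sqrt (n * ρ) < opNorm (pairMatrix g x) := hx
    have hx2 : 2 * (C₁ * Real.sqrt N) ≤ opNorm (pairMatrix g x) := by
      have := mul_le_mul_of_nonneg_left hsN hC₁0.le
      linarith
    have hx3 : 0 ≤ 2 * (C₁ * Real.sqrt N) := by positivity
    exact pow_le_pow_left₀ hx3 hx2 N
  refine hsub.trans ?_
  set m := (Measure.pi ν).real {x | (2 * (C₁ * Real.sqrt N)) ^ N ≤ opNorm (pairMatrix g x) ^ N}
  have h3 := hmk.trans hint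
  rw [mul_pow] at h3
  have h4 : (0 : ℝ) < (C₁ * Real.sqrt N) ^ N := by positivity
  -- The Markov threshold is twice the base of the moment bound, which gains 2^(−N); since √e ≤ 2
  -- this beats exp(−nρ/2).
  have h5 : 2 ^ N * m ≤ n := by
    refine le_of_mul_le_mul_right ?_ h4
    linarith
  have h6 : Real.exp (n * ρ / 2) ≤ 2 ^ N := by
    have h7 : Real.exp (1 / 2) ≤ 2 := by
      refine (pow_le_pow_iff_left₀ (Real.exp_pos _).le (by norm_num) two_ne_zero).1 ?_
      rw [← Real.exp_nat_mul]
      have := Real.exp_one_lt_d9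
      norm_num at this ⊢
      linarith
    calc Real.exp (n * ρ / 2) ≤ Real.exp (N * (1 / 2)) := by
          apply Real.exp_le_exp.2; rw [hNc]; linarith
      _ = Real.exp (1 / 2) ^ N := Real.exp_nat_mul _ _
      _ ≤ 2 ^ N := by gcongr
  have h7 : Real.exp (n * ρ / 2) * m ≤ n :=
    (mul_le_mul_of_nonneg_right h6 measureReal_nonneg).trans h5
  rw [neg_div, Real.exp_neg, ← div_eq_mul_inv, le_div_iff₀ (Real.exp_pos _)]
  linarith

end Tail

/-! ### The random graph in terms of its coins -/

section Coins

instance (p : ℝ) : IsProbabilityMeasure (coin p) := by unfold coin; infer_instance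

theorem integral_coin {p : ℝ} (hp : p ∈ Set.Icc (0 : ℝ) 1) (f : Bool → ℝ) :
    ∫ b, f b ∂(coin p) = p * f true + (1 - p) * f false := by
  rw [coin, integral_bernoulliMeasure, Set.projIcc_of_mem _ hp]
  simp

theorem integral_coin_prod {p s : ℝ} (hp : p ∈ Set.Icc (0 : ℝ) 1) (hs : s ∈ Set.Icc (0 : ℝ) 1)
    (f : Bool × Bool → ℝ) :
    ∫ y, f y ∂((coin p).prod (coin s)) =
      p * (s * f (true, true) + (1 - s) * f (true, false)) +
        (1 - p) * (s * f (false, true) + (1 - s) * f (false, false)) := by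
  rw [integral_prod _ Integrable.of_finite]
  simp_rw [integral_coin hs]
  rw [integral_coin hp]

/-- The law of the coins of one pair of nodes. -/
noncomputable def pairLaw {n : ℕ} (P S : Matrix (Fin n) (Fin n) ℝ) (e : Pair n) :
    Measure (Bool × Bool) :=
  (coin (P e.1.inf e.1.sup)).prod (coin (S e.1.inf e.1.sup))

instance {n : ℕ} (P S : Matrix (Fin n) (Fin n) ℝ) (e : Pair n) :
    IsProbabilityMeasure (pairLaw P S e) := by unfold pairLaw; infer_instance

/-- The value of the unsigned adjacency matrix at a pair with given coins. -/
def edgeValue (y : Bool × Bool) : ℝ := if y.1 = true then 1 else 0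

/-- The value of the signed adjacency matrix at a pair with given coins. -/
def signedValue (y : Bool × Bool) : ℝ :=
  if y.1 = true then (if y.2 = true then -1 else 1) else 0

variable {n : ℕ}

theorem adj_graphOfCoins (x : Pair n → Bool × Bool) :
    (graphOfCoins x).adj = pairMatrix (fun _ => signedValue) x := by
  ext i j
  simp only [SignedGraph.adj, pairMatrix, Matrix.of_apply, graphOfCoins, signedValue]
  by_cases h : (s(i, j) : Sym2 (Fin n)).IsDiag
  · simp [h]
  · by_cases h1 : (x ⟨s(i, j), h⟩).1 = true
    · by_cases h2 : (x ⟨s(i, j), h⟩).2 = true <;> simp [h, h1, h2]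
    · simp [h, h1]

theorem degree_graphOfCoins (x : Pair n → Bool × Bool) (i : Fin n) :
    (graphOfCoins x).degree i = ∑ j, pairMatrix (fun _ => edgeValue) x i j := by
  classical
  rw [SignedGraph.degree, ← SimpleGraph.card_neighborFinset_eq_degree,
    SimpleGraph.neighborFinset_eq_filter, Finset.card_filter, Nat.cast_sum]
  refine Finset.sum_congr rfl fun j _ => ?_
  simp only [graphOfCoins, pairMatrix, Matrix.of_apply, edgeValue]
  by_cases h : (s(i, j) : Sym2 (Fin n)).IsDiag
  · simp [h]
  · simp [h]

/-- Puts the deterministic mean in the same form as the random matrix, so that centring acts pair by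
pair. -/
theorem eq_pairMatrix {P : Matrix (Fin n) (Fin n) ℝ} (hP : P.IsSymm) (hP0 : ∀ i, P i i = 0)
    {Ω : Type*} (x : Pair n → Ω) :
    P = pairMatrix (fun e _ => P e.1.inf e.1.sup) x := by
  ext i j
  simp only [pairMatrix, Matrix.of_apply, Sym2.inf_mk, Sym2.sup_mk]
  split_ifs with h
  · rw [Sym2.mk_isDiag_iff] at h
    rw [h, hP0]
  · rcases le_total i j with hij | hij
    · rw [min_eq_left hij, max_eq_right hij]
    · rw [min_eq_right hij, max_eq_left hij, hP.apply]

theorem meanAdj_isSymm {P S : Matrix (Fin n) (Fin n) ℝ} (hP : P.IsSymm) (hS : S.IsSymm) :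
    (meanAdj P S).IsSymm :=
  Matrix.IsSymm.ext fun i j => by simp only [meanAdj, Matrix.of_apply, hP.apply i j, hS.apply i j]

open Classical in
/-- Row sums of a matrix indexed by pairs, as sums over the pairs containing a given node. -/
theorem sum_pairMatrix_row {Ω : Type*} (g : Pair n → Ω → ℝ) (x : Pair n → Ω) (i : Fin n) :
    ∑ j, pairMatrix g x i j = ∑ e : Pair n, if i ∈ e.1 then g e (x e) else 0 := by
  rw [← Finset.sum_filter, ← Finset.sum_filter_of_ne (p := fun j => ¬ (s(i, j) : Sym2 _).IsDiag)]
  · refine Finset.sum_bij (fun j hj => ⟨s(i, j), (Finset.mem_filter.1 hj).2⟩) ?_ ?_ ?_ ?_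
    · simp
    · intro j _ j' _ h
      exact Sym2.congr_right.1 (congrArg Subtype.val h)
    · rintro ⟨e, he⟩ hi
      obtain ⟨j, rfl⟩ := Sym2.mem_iff_exists.1 (Finset.mem_filter.1 hi).2
      exact ⟨j, by simpa using he, rfl⟩
    · intro j hj
      simp only [pairMatrix, Matrix.of_apply]
      rw [dif_pos (Finset.mem_filter.1 hj).2]
  · intro j _ hj hd
    exact hj (by simp only [pairMatrix, Matrix.of_apply]; rw [dif_neg (not_not.2 hd)])

variable {P S : Matrix (Fin n) (Fin n) ℝ}

/-- Lower tail of the degree of a node. -/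
theorem measure_degree_le (hP : P.IsSymm) (hP0 : ∀ i, P i i = 0)
    (hP1 : ∀ i j, P i j ∈ Set.Icc (0 : ℝ) 1) (hS1 : ∀ i j, S i j ∈ Set.Icc (0 : ℝ) 1) (i : Fin n) :
    (Measure.pi (pairLaw P S)).real {x | (graphOfCoins x).degree i ≤ meanDegree P i / 2} ≤
      Real.exp (-(meanDegree P i) / 10) := by
  classical
  set d := meanDegree P i with hd
  have hdsum : d = ∑ e : Pair n, if i ∈ e.1 then P e.1.inf e.1.sup else 0 := by
    have x : Pair n → Unit := fun _ => ()
    rw [hd, meanDegree, ← sum_pairMatrix_row (fun e _ => P e.1.inf e.1.sup) x,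
      ← eq_pairMatrix hP hP0]
  set f : Pair n → Bool × Bool → ℝ := fun e y => if i ∈ e.1 then Real.exp (-edgeValue y) else 1
    with hf
  have h1 : ∀ x, Real.exp (-(graphOfCoins x).degree i) = ∏ e, f e (x e) := by
    intro x
    rw [degree_graphOfCoins, sum_pairMatrix_row, ← Finset.sum_neg_distrib, Real.exp_sum]
    refine Finset.prod_congr rfl fun e _ => ?_
    simp only [hf]
    split_ifs <;> simp
  -- Chernoff with parameter 1: each factor is 1 − P(1 − 1/e) ≤ exp(−3P/5), and the threshold d/2
  -- leaves 3/5 − 1/2 = 1/10.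
  have he1 : Real.exp (-1) ≤ 2 / 5 := by
    rw [Real.exp_neg, inv_le_comm₀ (Real.exp_pos _) (by norm_num)]
    linarith [Real.exp_one_gt_d9]
  have hint : ∫ x, Real.exp (-(graphOfCoins x).degree i) ∂(Measure.pi (pairLaw P S)) ≤
      Real.exp (-(3 / 5) * d) := by
    simp_rw [h1]
    rw [integral_fintype_prod_eq_prod, hdsum, Finset.mul_sum, Real.exp_sum]
    refine Finset.prod_le_prod (fun e _ => integral_nonneg fun y => ?_) fun e _ => ?_
    · simp only [hf]
      split_ifs <;> positivity
    · simp only [hf]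
      split_ifs with hi
      · rw [pairLaw, integral_coin_prod (hP1 _ _) (hS1 _ _)]
        have h2 := Real.add_one_le_exp (-(3 / 5) * P e.1.inf e.1.sup)
        have h3 := (hP1 e.1.inf e.1.sup).1
        simp only [edgeValue, if_true, Bool.false_eq_true, if_false, neg_zero, Real.exp_zero]
        nlinarith
      · simp
  have hmk := mul_meas_ge_le_integral_of_nonneg (μ := Measure.pi (pairLaw P S))
    (f := fun x => Real.exp (-(graphOfCoins x).degree i))
    (ae_of_all _ fun x => (Real.exp_pos _).le) Integrable.of_finite (Real.exp (-(d / 2)))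
  have hset : {x : Pair n → Bool × Bool | (graphOfCoins x).degree i ≤ d / 2} =
      {x | Real.exp (-(d / 2)) ≤ Real.exp (-(graphOfCoins x).degree i)} := by
    ext x
    simp
  rw [hset]
  refine le_of_mul_le_mul_left ((hmk.trans hint).trans_eq ?_) (Real.exp_pos (-(d / 2)))
  rw [← Real.exp_add]
  congr 1
  ring

/-- The centred signed entry of the adjacency matrix, halved. -/
noncomputable def centredSigned (P S : Matrix (Fin n) (Fin n) ℝ) (e : Pair n) (y : Bool × Bool) :
    ℝ :=
  (signedValue y - P e.1.inf e.1.sup * (1 - 2 * S e.1.inf e.1.sup)) / 2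

/-- The centred edge indicator. -/
def centredEdge (P : Matrix (Fin n) (Fin n) ℝ) (e : Pair n) (y : Bool × Bool) : ℝ :=
  edgeValue y - P e.1.inf e.1.sup

/-- The factor 2 undoes the halving, which keeps the centred entries in [−1, 1] for the norm tail.
-/
theorem adj_sub_meanAdj (hP : P.IsSymm) (hP0 : ∀ i, P i i = 0) (hS : S.IsSymm)
    (x : Pair n → Bool × Bool) :
    (graphOfCoins x).adj - meanAdj P S = (2 : ℝ) • pairMatrix (centredSigned P S) x := by
  rw [adj_graphOfCoins, eq_pairMatrix (meanAdj_isSymm hP hS) (fun i => by simp [meanAdj, hP0]) x]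
  ext i j
  simp only [pairMatrix, Matrix.sub_apply, Matrix.smul_apply, Matrix.of_apply, centredSigned,
    meanAdj, smul_eq_mul]
  split_ifs <;> ring

/-- All degree errors are thus controlled at once, in ℓ², by a spectral norm; a uniform bound on
them would cost a logarithm. -/
theorem degree_sub_meanDegree (hP : P.IsSymm) (hP0 : ∀ i, P i i = 0)
    (x : Pair n → Bool × Bool) :
    (fun i => (graphOfCoins x).degree i - meanDegree P i) =
      (pairMatrix (centredEdge P) x).mulVec 1 := by
  funext i
  rw [degree_graphOfCoins, meanDegree, ← Finset.sum_sub_distrib, Matrix.mulVec, dotProduct]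
  refine Finset.sum_congr rfl fun j _ => ?_
  conv_lhs => rw [eq_pairMatrix hP hP0 x]
  simp only [pairMatrix, Matrix.of_apply, centredEdge, Pi.one_apply, mul_one]
  split_ifs <;> ring

theorem integral_centredSigned (e : Pair n) (hP1 : ∀ i j, P i j ∈ Set.Icc (0 : ℝ) 1)
    (hS1 : ∀ i j, S i j ∈ Set.Icc (0 : ℝ) 1) :
    ∫ y, centredSigned P S e y ∂(pairLaw P S e) = 0 := by
  rw [pairLaw, integral_coin_prod (hP1 _ _) (hS1 _ _)]
  simp only [centredSigned, signedValue, if_true, Bool.false_eq_true, if_false]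
  ring

theorem integral_centredEdge (e : Pair n) (hP1 : ∀ i j, P i j ∈ Set.Icc (0 : ℝ) 1)
    (hS1 : ∀ i j, S i j ∈ Set.Icc (0 : ℝ) 1) :
    ∫ y, centredEdge P e y ∂(pairLaw P S e) = 0 := by
  rw [pairLaw, integral_coin_prod (hP1 _ _) (hS1 _ _)]
  simp only [centredEdge, edgeValue, if_true, Bool.false_eq_true, if_false]
  ring

theorem integral_centredSigned_sq_le (e : Pair n) (hP1 : ∀ i j, P i j ∈ Set.Icc (0 : ℝ) 1)
    (hS1 : ∀ i j, S i j ∈ Set.Icc (0 : ℝ) 1) :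
    ∫ y, centredSigned P S e y ^ 2 ∂(pairLaw P S e) ≤ P e.1.inf e.1.sup := by
  rw [pairLaw, integral_coin_prod (hP1 _ _) (hS1 _ _)]
  simp only [centredSigned, signedValue, if_true, Bool.false_eq_true, if_false]
  nlinarith [sq_nonneg (P e.1.inf e.1.sup * (1 - 2 * S e.1.inf e.1.sup)),
    (hP1 e.1.inf e.1.sup).1]

theorem integral_centredEdge_sq_le (e : Pair n) (hP1 : ∀ i j, P i j ∈ Set.Icc (0 : ℝ) 1)
    (hS1 : ∀ i j, S i j ∈ Set.Icc (0 : ℝ) 1) :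
    ∫ y, centredEdge P e y ^ 2 ∂(pairLaw P S e) ≤ P e.1.inf e.1.sup := by
  rw [pairLaw, integral_coin_prod (hP1 _ _) (hS1 _ _)]
  simp only [centredEdge, edgeValue, if_true, Bool.false_eq_true, if_false]
  nlinarith [sq_nonneg (P e.1.inf e.1.sup)]

theorem abs_centredSigned_le (e : Pair n) (y : Bool × Bool)
    (hP1 : ∀ i j, P i j ∈ Set.Icc (0 : ℝ) 1) (hS1 : ∀ i j, S i j ∈ Set.Icc (0 : ℝ) 1) :
    |centredSigned P S e y| ≤ 1 := by
  have h1 : |signedValue y| ≤ 1 := by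
    unfold signedValue; split_ifs <;> norm_num
  obtain ⟨hp0, hp1⟩ := hP1 e.1.inf e.1.sup
  obtain ⟨hs0, hs1⟩ := hS1 e.1.inf e.1.sup
  rw [abs_le] at h1
  rw [centredSigned, abs_le]
  constructor <;> nlinarith

theorem abs_centredEdge_le (e : Pair n) (y : Bool × Bool)
    (hP1 : ∀ i j, P i j ∈ Set.Icc (0 : ℝ) 1) : |centredEdge P e y| ≤ 1 := by
  obtain ⟨hp0, hp1⟩ := hP1 e.1.inf e.1.sup
  rw [centredEdge, edgeValue, abs_le]
  split_ifs <;> constructor <;> linarith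

end Coins

/-! ### Perturbation of the normalized Laplacian -/

section Deterministic

variable {V : Type*} [Fintype V] [DecidableEq V]

theorem normalizedLaplacianOf_eq {d : V → ℝ} (hd : ∀ i, 0 < d i) (A : Matrix V V ℝ) :
    normalizedLaplacianOf d A = 1 - invSqrtDiag d * A * invSqrtDiag d := by
  have h : invSqrtDiag d * Matrix.diagonal d * invSqrtDiag d = 1 := by
    rw [invSqrtDiag, Matrix.diagonal_mul_diagonal, Matrix.diagonal_mul_diagonal,
      ← Matrix.diagonal_one]
    congr 1
    funext i
    have h1 := Real.sqrt_pos.2 (hd i)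
    have h2 := Real.mul_self_sqrt (hd i).le
    field_simp
    rw [pow_two, h2]
  rw [normalizedLaplacianOf, mul_sub, sub_mul, h]

theorem opNorm_diagonal_le {v : V → ℝ} {c : ℝ} (hc : 0 ≤ c) (hv : ∀ i, |v i| ≤ c) :
    opNorm (Matrix.diagonal v) ≤ c := by
  refine ContinuousLinearMap.opNorm_le_bound _ hc fun x => ?_
  rw [EuclideanSpace.norm_eq, EuclideanSpace.norm_eq, ← Real.sqrt_sq hc,
    ← Real.sqrt_mul (sq_nonneg c), Finset.mul_sum]
  refine Real.sqrt_le_sqrt (Finset.sum_le_sum fun i _ => ?_)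
  rw [Matrix.ofLp_toEuclideanCLM, Matrix.mulVec_diagonal, norm_mul, mul_pow]
  gcongr
  exact hv i

/-- Rationalizing gives denominator √a√b(√a + √b), where √a√b ≥ m/2 and √a + √b ≥ √m. -/
theorem abs_inv_sqrt_sub_inv_sqrt_le {m a b : ℝ} (hm : 0 < m) (ha : m / 2 ≤ a) (hb : m ≤ b) :
    |(Real.sqrt a)⁻¹ - (Real.sqrt b)⁻¹| * (m * Real.sqrt m) ≤ 2 * |a - b| := by
  have ha0 : 0 < a := by linarith
  have hb0 : 0 < b := by linarith
  have hsm := Real.sqrt_pos.2 hm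
  have hsa := Real.sqrt_pos.2 ha0
  have hsb := Real.sqrt_pos.2 hb0
  have h1 : a - b = (Real.sqrt a - Real.sqrt b) * (Real.sqrt a + Real.sqrt b) := by
    have := Real.mul_self_sqrt ha0.le
    have := Real.mul_self_sqrt hb0.le
    linarith
  have h2 : (Real.sqrt a)⁻¹ - (Real.sqrt b)⁻¹ =
      -(Real.sqrt a - Real.sqrt b) / (Real.sqrt a * Real.sqrt b) := by
    field_simp
    ring
  have h3 : m ≤ 2 * (Real.sqrt a * Real.sqrt b) := by
    have h4 : m / 2 ≤ Real.sqrt a * Real.sqrt b := by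
      rw [← Real.sqrt_mul ha0.le]
      refine Real.le_sqrt_of_sq_le ?_
      nlinarith
    linarith
  have h5 : Real.sqrt m ≤ Real.sqrt a + Real.sqrt b := by
    have := Real.sqrt_le_sqrt hb
    linarith
  rw [h2, h1, abs_div, abs_neg, abs_mul (Real.sqrt a - Real.sqrt b), abs_of_pos (mul_pos hsa hsb),
    abs_of_pos (add_pos hsa hsb), div_mul_eq_mul_div, div_le_iff₀ (mul_pos hsa hsb)]
  have h6 : m * Real.sqrt m ≤ 2 * (Real.sqrt a * Real.sqrt b) * (Real.sqrt a + Real.sqrt b) :=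
    mul_le_mul h3 h5 hsm.le (by positivity)
  calc |Real.sqrt a - Real.sqrt b| * (m * Real.sqrt m)
      ≤ |Real.sqrt a - Real.sqrt b| *
          (2 * (Real.sqrt a * Real.sqrt b) * (Real.sqrt a + Real.sqrt b)) := by gcongr
    _ = _ := by ring

theorem inv_sqrt_mul_sqrt_le {m a : ℝ} (hm : 0 < m) (ha : m / 2 ≤ a) :
    (Real.sqrt a)⁻¹ * Real.sqrt m ≤ Real.sqrt 2 := by
  have ha0 : 0 < a := by linarith
  rw [inv_mul_le_iff₀ (Real.sqrt_pos.2 ha0), ← Real.sqrt_mul ha0.le]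
  exact Real.sqrt_le_sqrt (by linarith)

theorem abs_inv_sqrt_mul_sub_le {m a b a' b' : ℝ} (hm : 0 < m) (ha : m / 2 ≤ a) (hb : m ≤ b)
    (ha' : m / 2 ≤ a') (hb' : m ≤ b') :
    |(Real.sqrt a)⁻¹ * (Real.sqrt a')⁻¹ - (Real.sqrt b)⁻¹ * (Real.sqrt b')⁻¹| * m ^ 2 ≤
      4 * (|a - b| + |a' - b'|) := by
  have h1 := abs_inv_sqrt_sub_inv_sqrt_le hm ha hb
  have h2 := abs_inv_sqrt_sub_inv_sqrt_le hm ha' hb'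
  have h3 := inv_sqrt_mul_sqrt_le hm ha
  have h4 := inv_sqrt_mul_sqrt_le hm (a := b') (by linarith)
  have h5 : Real.sqrt 2 ≤ 2 := Real.sqrt_le_iff.2 (by norm_num)
  have hsm := Real.mul_self_sqrt hm.le
  set x := (Real.sqrt a)⁻¹ with hx
  set y := (Real.sqrt b)⁻¹
  set x' := (Real.sqrt a')⁻¹
  set y' := (Real.sqrt b')⁻¹ with hy'
  have hx0 : 0 ≤ x := inv_nonneg.2 (Real.sqrt_nonneg _)
  have hy0 : 0 ≤ y' := inv_nonneg.2 (Real.sqrt_nonneg _)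
  have e : x * x' - y * y' = x * (x' - y') + y' * (x - y) := by ring
  calc |x * x' - y * y'| * m ^ 2 ≤ (x * |x' - y'| + y' * |x - y|) * m ^ 2 := by
        rw [e]
        gcongr
        refine (abs_add_le _ _).trans_eq ?_
        rw [abs_mul, abs_mul, abs_of_nonneg hx0, abs_of_nonneg hy0]
    _ = (x * Real.sqrt m) * (|x' - y'| * (m * Real.sqrt m)) +
          (y' * Real.sqrt m) * (|x - y| * (m * Real.sqrt m)) := by
        have : m ^ 2 = m * (Real.sqrt m * Real.sqrt m) := by rw [hsm]; ring
        rw [this]; ring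
    _ ≤ 2 * (2 * |a' - b'|) + 2 * (2 * |a - b|) := by
        gcongr
        · linarith
        · linarith
    _ = _ := by ring

/-- Perturbation of the normalized Laplacian: it is controlled by the operator norm of the
perturbation of the adjacency matrix and the `ℓ²`-norm of the perturbation of the degrees. -/
theorem opNorm_normalizedLaplacianOf_sub_le {d d' : V → ℝ} {A A' : Matrix V V ℝ} {m p R κ : ℝ}
    (hm : 0 < m) (hp : 0 ≤ p) (hR : 0 ≤ R) (hd' : ∀ i, m ≤ d' i) (hd : ∀ i, m / 2 ≤ d i)
    (hA' : ∀ i j, |A' i j| ≤ p) (hpn : Fintype.card V * p ≤ κ * m)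
    (hA : opNorm (A - A') ≤ R) (hdd : ∑ i, (d i - d' i) ^ 2 ≤ Fintype.card V * R ^ 2) :
    opNorm (normalizedLaplacianOf d A - normalizedLaplacianOf d' A') ≤
      (2 + 8 * κ) * R / m := by
  set n : ℝ := (Fintype.card V : ℝ) with hn
  set D := invSqrtDiag d with hD
  set D' := invSqrtDiag d' with hD'
  rw [normalizedLaplacianOf_eq (fun i => lt_of_lt_of_le (by linarith) (hd i)),
    normalizedLaplacianOf_eq (fun i => lt_of_lt_of_le hm (hd' i))]
  -- The first term carries the adjacency error and is bounded in spectral norm; the second carries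
  -- only the degree error.
  have e : 1 - D * A * D - (1 - D' * A' * D') =
      -(D * (A - A') * D) + -(D * A' * D - D' * A' * D') := by
    rw [mul_sub, sub_mul]; abel
  have hsm := Real.sqrt_pos.2 hm
  have hDn : opNorm D ≤ Real.sqrt 2 / Real.sqrt m := by
    refine opNorm_diagonal_le (by positivity) fun i => ?_
    rw [abs_of_nonneg (inv_nonneg.2 (Real.sqrt_nonneg _)), le_div_iff₀ hsm]
    exact inv_sqrt_mul_sqrt_le hm (hd i)
  have h1 : opNorm (D * (A - A') * D) ≤ 2 * R / m := by
    calc opNorm (D * (A - A') * D) ≤ opNorm D * opNorm (A - A') * opNorm D :=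
          (opNorm_mul_le _ _).trans
            (mul_le_mul_of_nonneg_right (opNorm_mul_le _ _) (opNorm_nonneg _))
      _ ≤ Real.sqrt 2 / Real.sqrt m * R * (Real.sqrt 2 / Real.sqrt m) := by
          gcongr
          · exact opNorm_nonneg _
          · exact opNorm_nonneg _
      _ = (Real.sqrt 2 * Real.sqrt 2) * R / (Real.sqrt m * Real.sqrt m) := by ring
      _ = 2 * R / m := by rw [Real.mul_self_sqrt hm.le, Real.mul_self_sqrt (by norm_num)]
  -- The Frobenius norm suffices: the squared entries sum to at most 64(np)²R²/m⁴, and np ≤ κm.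
  have h2 : opNorm (D * A' * D - D' * A' * D') ≤ 8 * κ * R / m := by
    refine (opNorm_le_sqrt_sum_sq _).trans (Real.sqrt_le_iff.2 ⟨?_, ?_⟩)
    · have : 0 ≤ κ * m := le_trans (by positivity) hpn
      have : 0 ≤ κ := nonneg_of_mul_nonneg_left this hm
      positivity
    have h3 : ∀ i j, (D * A' * D - D' * A' * D') i j ^ 2 ≤
        32 * p ^ 2 / m ^ 4 * ((d i - d' i) ^ 2 + (d j - d' j) ^ 2) := by
      intro i j
      have h4 : (D * A' * D - D' * A' * D') i j =
          A' i j * ((Real.sqrt (d i))⁻¹ * (Real.sqrt (d j))⁻¹ -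
            (Real.sqrt (d' i))⁻¹ * (Real.sqrt (d' j))⁻¹) := by
        simp only [hD, hD', invSqrtDiag, Matrix.sub_apply, Matrix.mul_diagonal,
          Matrix.diagonal_mul]
        ring
      have h5 := abs_inv_sqrt_mul_sub_le hm (hd i) (hd' i) (hd j) (hd' j)
      rw [h4, mul_pow, ← sq_abs, div_mul_eq_mul_div, le_div_iff₀ (by positivity)]
      set z := (Real.sqrt (d i))⁻¹ * (Real.sqrt (d j))⁻¹ -
            (Real.sqrt (d' i))⁻¹ * (Real.sqrt (d' j))⁻¹
      calc |A' i j| ^ 2 * z ^ 2 * m ^ 4 = |A' i j| ^ 2 * (|z| * m ^ 2) ^ 2 := by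
            rw [← sq_abs z]; ring
        _ ≤ p ^ 2 * (4 * (|d i - d' i| + |d j - d' j|)) ^ 2 := by
            gcongr
            exact hA' i j
        _ ≤ p ^ 2 * (32 * (|d i - d' i| ^ 2 + |d j - d' j| ^ 2)) := by
            gcongr
            nlinarith [sq_nonneg (|d i - d' i| - |d j - d' j|)]
        _ = _ := by rw [sq_abs, sq_abs]; ring
    calc ∑ i, ∑ j, (D * A' * D - D' * A' * D') i j ^ 2
        ≤ ∑ i, ∑ j, 32 * p ^ 2 / m ^ 4 * ((d i - d' i) ^ 2 + (d j - d' j) ^ 2) :=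
          Finset.sum_le_sum fun i _ => Finset.sum_le_sum fun j _ => h3 i j
      _ = 64 * p ^ 2 / m ^ 4 * n * ∑ i, (d i - d' i) ^ 2 := by
          simp only [← Finset.mul_sum, Finset.sum_add_distrib, Finset.sum_const,
            Finset.card_univ, nsmul_eq_mul, ← hn]
          ring
      _ ≤ 64 * p ^ 2 / m ^ 4 * n * (n * R ^ 2) := by gcongr
      _ = 64 * (n * p) ^ 2 * R ^ 2 / m ^ 4 := by ring
      _ ≤ 64 * (κ * m) ^ 2 * R ^ 2 / m ^ 4 := by gcongr
      _ = (8 * κ * R / m) ^ 2 := by field_simp; ring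
  rw [e]
  refine (opNorm_add_le _ _).trans ?_
  rw [opNorm_neg, opNorm_neg]
  calc _ ≤ 2 * R / m + 8 * κ * R / m := add_le_add h1 h2
    _ = _ := by ring

end Deterministic

/-! ### Concentration for general edge probabilities -/

section Concentration

variable {n : ℕ} {P S : Matrix (Fin n) (Fin n) ℝ}

theorem le_meanDegree {q m : ℝ} (hP0 : ∀ i, P i i = 0) (hq : ∀ i j, i ≠ j → q ≤ P i j)
    (hm : m ≤ (n - 1) * q) (i : Fin n) : m ≤ meanDegree P i := by
  have hn : 1 ≤ n := by have := i.2; omega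
  refine hm.trans ?_
  rw [meanDegree, ← Finset.add_sum_erase _ _ (Finset.mem_univ i), hP0, zero_add]
  have := Finset.card_nsmul_le_sum (Finset.univ.erase i) (fun j => P i j) q
    fun j hj => hq i j (Finset.ne_of_mem_erase hj).symm
  rw [Finset.card_erase_of_mem (Finset.mem_univ i), Finset.card_univ, Fintype.card_fin,
    nsmul_eq_mul, Nat.cast_sub hn, Nat.cast_one] at this
  exact this

theorem abs_meanAdj_le {p : ℝ} (hP1 : ∀ i j, P i j ∈ Set.Icc 0 p)
    (hS1 : ∀ i j, S i j ∈ Set.Icc (0 : ℝ) 1) (i j : Fin n) : |meanAdj P S i j| ≤ p := by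
  obtain ⟨h1, h2⟩ := hP1 i j
  obtain ⟨h3, h4⟩ := hS1 i j
  simp only [meanAdj, Matrix.of_apply]
  rw [abs_mul, abs_of_nonneg h1]
  have : |1 - 2 * S i j| ≤ 1 := by rw [abs_le]; constructor <;> linarith
  nlinarith

/-- Concentration of the normalized Laplacian of the signed inhomogeneous Erdős–Rényi model, when
all edge probabilities are at most `p` and all expected degrees are at least `m`. -/
theorem exists_normalizedLaplacian_tail :
    ∃ C : ℝ, 0 < C ∧ ∀ {n : ℕ} {P S : Matrix (Fin n) (Fin n) ℝ} {p m κ : ℝ},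
      P.IsSymm → S.IsSymm → (∀ i, P i i = 0) → (∀ i j, P i j ∈ Set.Icc 0 p) → p ≤ 1 →
      (∀ i j, S i j ∈ Set.Icc (0 : ℝ) 1) → 1 ≤ n * p → 0 < m → (∀ i, m ≤ meanDegree P i) →
      n * p ≤ κ * m →
      (Measure.pi (pairLaw P S)).real {x | (2 + 8 * κ) * (C * Real.sqrt (n * p)) / m <
          opNorm ((graphOfCoins x).normalizedLaplacian - meanNormalizedLaplacian P S)} ≤
        2 * (n * Real.exp (-(n * p) / 2)) + n * Real.exp (-m / 10) := by
  obtain ⟨C, hC, htail⟩ := exists_opNorm_pairMatrix_tail (Ω := Bool × Bool)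
  refine ⟨2 * C, by positivity, ?_⟩
  intro n P S p m κ hP hS hP0 hPp hp1 hS1 hnp hm hdeg hκ
  have hP1 : ∀ i j, P i j ∈ Set.Icc (0 : ℝ) 1 := fun i j => ⟨(hPp i j).1, (hPp i j).2.trans hp1⟩
  have hp0 : 0 ≤ p := by
    by_contra h
    have : (n : ℝ) * p ≤ 0 := mul_nonpos_of_nonneg_of_nonpos n.cast_nonneg (not_le.1 h).le
    linarith
  set ν := Measure.pi (pairLaw P S) with hν
  set r := Real.sqrt (n * p) with hr
  have hr0 : 0 ≤ r := Real.sqrt_nonneg _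
  have hA := htail (pairLaw P S) (centredSigned P S) p hp0 hp1 hnp
    (fun e => integral_centredSigned e hP1 hS1) (fun e y => abs_centredSigned_le e y hP1 hS1)
    (fun e => (integral_centredSigned_sq_le e hP1 hS1).trans (hPp _ _).2)
  have hB := htail (pairLaw P S) (centredEdge P) p hp0 hp1 hnp
    (fun e => integral_centredEdge e hP1 hS1) (fun e y => abs_centredEdge_le e y hP1)
    (fun e => (integral_centredEdge_sq_le e hP1 hS1).trans (hPp _ _).2)
  have hD : ν.real (⋃ i, {x | (graphOfCoins x).degree i ≤ meanDegree P i / 2}) ≤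
      n * Real.exp (-m / 10) := by
    refine (measureReal_iUnion_fintype_le _).trans ?_
    calc ∑ i, ν.real {x | (graphOfCoins x).degree i ≤ meanDegree P i / 2}
        ≤ ∑ _i : Fin n, Real.exp (-m / 10) := by
          refine Finset.sum_le_sum fun i _ => (measure_degree_le hP hP0 hP1 hS1 i).trans ?_
          have := hdeg i
          gcongr
      _ = _ := by simp
  set a := {x | C * r < opNorm (pairMatrix (centredSigned P S) x)} with ha
  set b := {x | C * r < opNorm (pairMatrix (centredEdge P) x)} with hb
  set c := ⋃ i, {x | (graphOfCoins x).degree i ≤ meanDegree P i / 2} with hc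
  -- Outside three bad events (large signed error, large edge error, some degree at most half its
  -- mean) the perturbation bound applies with R = 2Cr; the 2 comes from the halved entries.
  have hsub : {x | (2 + 8 * κ) * (2 * C * r) / m <
      opNorm ((graphOfCoins x).normalizedLaplacian - meanNormalizedLaplacian P S)} ⊆
      a ∪ b ∪ c := by
    intro x hx
    by_contra hcon
    simp only [Set.mem_union, not_or, ha, hb, hc, Set.mem_ofPred_eq, Set.mem_iUnion, not_exists,
      not_lt, not_le] at hcon
    obtain ⟨⟨h1, h2⟩, h3⟩ := hcon
    rw [Set.mem_ofPred_eq] at hx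
    refine absurd hx (not_lt.2 ?_)
    refine opNorm_normalizedLaplacianOf_sub_le (p := p) hm hp0 (by positivity) hdeg
      (fun i => ?_) (abs_meanAdj_le hPp hS1) ?_ ?_ ?_
    · have := h3 i
      have := hdeg i
      linarith
    · rwa [Fintype.card_fin]
    · rw [adj_sub_meanAdj hP hP0 hS, opNorm_smul, abs_of_pos two_pos]
      linarith
    · have h4 := norm_toLp_mulVec_le (pairMatrix (centredEdge P) x) 1
      rw [← degree_sub_meanDegree hP hP0] at h4
      have h5 := pow_le_pow_left₀ (norm_nonneg _) h4 2
      rw [mul_pow, EuclideanSpace.norm_sq_eq, EuclideanSpace.norm_sq_eq] at h5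
      simp only [Real.norm_eq_abs, sq_abs, Pi.one_apply, one_pow, Finset.sum_const,
        Finset.card_univ, Fintype.card_fin, nsmul_eq_mul, mul_one] at h5
      rw [Fintype.card_fin]
      refine h5.trans ?_
      rw [mul_comm]
      gcongr
      · exact opNorm_nonneg _
      · exact h2.trans (by nlinarith [mul_nonneg hC.le hr0])
  calc _ ≤ ν.real (a ∪ b ∪ c) := measureReal_mono hsub
    _ ≤ ν.real a + ν.real b + ν.real c :=
        (measureReal_union_le _ _).trans (add_le_add_left (measureReal_union_le _ _) _)
    _ ≤ _ := by linarith

end Concentration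

/-! ### The bisection model in the dense regime -/

section Bisection

theorem blockExtend_isSymm {n m : ℕ} (c : Fin n → Fin m) {Q : Matrix (Fin m) (Fin m) ℝ}
    (hQ : Q.IsSymm) : (blockExtend c Q).IsSymm := by
  refine Matrix.IsSymm.ext fun i j => ?_
  simp only [blockExtend, Matrix.of_apply, eq_comm (a := j), hQ.apply]

theorem isSymm_two (a b : ℝ) : (!![a, b; b, a] : Matrix (Fin 2) (Fin 2) ℝ).IsSymm := by
  refine Matrix.IsSymm.ext fun i j => ?_
  fin_cases i <;> fin_cases j <;> rfl

theorem blockExtend_two_of_ne {n : ℕ} (c : Fin n → Fin 2) (a b : ℝ) {i j : Fin n} (hij : i ≠ j) :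
    blockExtend c !![a, b; b, a] i j = a ∨ blockExtend c !![a, b; b, a] i j = b := by
  simp only [blockExtend, Matrix.of_apply, if_neg hij]
  generalize c i = x
  generalize c j = y
  fin_cases x <;> fin_cases y <;> simp

theorem blockExtend_diag {n m : ℕ} (c : Fin n → Fin m) (Q : Matrix (Fin m) (Fin m) ℝ)
    (i : Fin n) : blockExtend c Q i i = 0 := by simp [blockExtend]

theorem blockExtend_two_mem_Icc {n : ℕ} (c : Fin n → Fin 2) {a b p : ℝ} (ha : a ∈ Set.Icc 0 p)
    (hb : b ∈ Set.Icc 0 p) (i j : Fin n) : blockExtend c !![a, b; b, a] i j ∈ Set.Icc 0 p := by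
  rcases eq_or_ne i j with rfl | hij
  · rw [blockExtend_diag]
    exact Set.mem_Icc.2 ⟨le_rfl, ha.1.trans ha.2⟩
  · rcases blockExtend_two_of_ne c a b hij with h | h <;> rwa [h]

end Bisection

-- Used with t = √k, for which k^(−2) = t^(−4).
open Filter in
theorem eventually_pow_mul_exp_le {c : ℝ} (hc : 0 < c) :
    ∀ᶠ t : ℝ in atTop, 6 * t ^ 2 * Real.exp (-c * t) ≤ (t ^ 4)⁻¹ := by
  have h := tendsto_rpow_mul_exp_neg_mul_atTop_nhds_zero 6 c hc
  filter_upwards [h.eventually (gt_mem_nhds (by norm_num : (0 : ℝ) < 1 / 6)),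
    eventually_gt_atTop 0] with t ht ht0
  rw [← one_div, le_div_iff₀ (by positivity)]
  have : t ^ (6 : ℝ) = t ^ 6 := by exact_mod_cast Real.rpow_natCast t 6
  rw [this] at ht
  calc 6 * t ^ 2 * Real.exp (-c * t) * t ^ 4 = 6 * (t ^ 6 * Real.exp (-c * t)) := by ring
    _ ≤ 1 := by linarith

/-- A tail bound on the coins gives a lower bound on the probability of the complementary event
for every random graph with the corresponding law. -/
theorem ofReal_one_sub_le_of_hasLaw {n : ℕ} {P S : Matrix (Fin n) (Fin n) ℝ} {Ω : Type*}
    [MeasurableSpace Ω] {μ : Measure Ω} {G : Ω → SignedGraph (Fin n)}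
    (hG : HasLaw G (signedErdosRenyi P S) μ) (f : SignedGraph (Fin n) → ℝ) {K ε : ℝ}
    (h : (Measure.pi (pairLaw P S)).real {x | K < f (graphOfCoins x)} ≤ ε) :
    ENNReal.ofReal (1 - ε) ≤ μ {ω | f (G ω) ≤ K} := by
  have hmeas : Measurable (graphOfCoins (n := n)) := Measurable.of_discrete
  rw [hG.measure_eq (p := fun g => f g ≤ K) trivial, signedErdosRenyi,
    Measure.map_apply hmeas trivial]
  change _ ≤ Measure.pi (pairLaw P S) {x | f (graphOfCoins x) ≤ K}
  have hcompl : {x : Pair n → Bool × Bool | f (graphOfCoins x) ≤ K} =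
      {x | K < f (graphOfCoins x)}ᶜ := by
    ext x; simp
  rw [← ofReal_measureReal, hcompl, probReal_compl_eq_one_sub (Set.toFinite _).measurableSet]
  exact ENNReal.ofReal_le_ofReal (by linarith)

end SignedER

theorem proposition4p4 (γ₁ γ₂ s : ℝ) (hγ₂ : 0 < γ₂) (hγ : γ₂ < γ₁) (hs₀ : 0 < s) (hs : s < 1 / 2) :
    ∃ C : ℝ, 0 < C ∧ ∃ k₀ : ℕ, ∀ k : ℕ, 2 ≤ k → k₀ ≤ k →
      ∀ {Ω : Type*} [MeasurableSpace Ω] (μ : Measure Ω) [IsProbabilityMeasure μ]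
        (G : Ω → SignedER.SignedGraph (Fin (2 * k))),
        HasLaw G (SignedER.signedBlock k (γ₁ * (k : ℝ) ^ (-(1 / 2) : ℝ))
          (γ₂ * (k : ℝ) ^ (-(1 / 2) : ℝ)) s) μ →
        ENNReal.ofReal (1 - (k : ℝ) ^ (-2 : ℝ)) ≤
          μ {ω | SignedER.opNorm ((G ω).normalizedLaplacian -
              SignedER.signedBlockMeanLaplacian k (γ₁ * (k : ℝ) ^ (-(1 / 2) : ℝ))
                (γ₂ * (k : ℝ) ^ (-(1 / 2) : ℝ)) s) ≤ C * (k : ℝ) ^ (-(1 / 4) : ℝ)} := by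
  obtain ⟨C, hC, htail⟩ := SignedER.exists_normalizedLaplacian_tail
  have hγ₁ : 0 < γ₁ := hγ₂.trans hγ
  -- With t = √k one has np = 2γ₁t and m = γ₂t, so this is exactly np/m.
  set κ := 2 * γ₁ / γ₂ with hκ
  have hκ0 : 0 < κ := by positivity
  have hev : ∀ᶠ k : ℕ in Filter.atTop, γ₁ ≤ Real.sqrt k ∧ 1 ≤ 2 * γ₁ * Real.sqrt k ∧
      6 * Real.sqrt k ^ 2 * Real.exp (-(γ₂ / 10) * Real.sqrt k) ≤ (Real.sqrt k ^ 4)⁻¹ := by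
    have ht : Filter.Tendsto (fun k : ℕ => Real.sqrt k) Filter.atTop Filter.atTop :=
      Real.tendsto_sqrt_atTop.comp tendsto_natCast_atTop_atTop
    filter_upwards [ht.eventually_ge_atTop γ₁, ht.eventually_ge_atTop (1 / (2 * γ₁)),
      ht.eventually (SignedER.eventually_pow_mul_exp_le (by positivity : 0 < γ₂ / 10))]
      with k h1 h2 h3
    refine ⟨h1, ?_, h3⟩
    rw [div_le_iff₀ (by positivity)] at h2
    linarith
  obtain ⟨k₀, hk₀⟩ := Filter.eventually_atTop.1 hev
  refine ⟨(2 + 8 * κ) * (C * Real.sqrt (2 * γ₁)) / γ₂, by positivity, k₀, ?_⟩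
  intro k hk2 hk Ω _ μ _ G hG
  obtain ⟨h1, h2, h3⟩ := hk₀ k hk
  set t := Real.sqrt k with ht
  have hk0 : (2 : ℝ) ≤ k := by exact_mod_cast hk2
  have hkt : (k : ℝ) = t ^ 2 := (Real.sq_sqrt (by linarith)).symm
  have ht0 : 0 < t := Real.sqrt_pos.2 (by linarith)
  have e1 : (k : ℝ) ^ (-(1 / 2) : ℝ) = t⁻¹ := by
    rw [Real.rpow_neg (by linarith), ← Real.sqrt_eq_rpow]
  have e2 : (k : ℝ) ^ (-2 : ℝ) = (t ^ 4)⁻¹ := by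
    rw [Real.rpow_neg (by linarith), Real.rpow_two, hkt]
    ring
  have e3 : (k : ℝ) ^ (-(1 / 4) : ℝ) = (Real.sqrt t)⁻¹ := by
    rw [Real.rpow_neg (by linarith), ht, Real.sqrt_eq_rpow, Real.sqrt_eq_rpow,
      ← Real.rpow_mul (by linarith)]
    norm_num
  rw [e1] at hG
  rw [e1, e2, e3]
  have hnp : ((2 * k : ℕ) : ℝ) * (γ₁ * t⁻¹) = 2 * γ₁ * t := by
    push_cast
    rw [hkt]
    field_simp
  have hp1 : γ₁ * t⁻¹ ≤ 1 := by
    rw [← div_eq_mul_inv, div_le_one ht0]; exact h1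
  have hqp : γ₂ * t⁻¹ ≤ γ₁ * t⁻¹ := by gcongr
  have hP0 : ∀ i, SignedER.edgeProb k (γ₁ * t⁻¹) (γ₂ * t⁻¹) i i = 0 :=
    SignedER.blockExtend_diag _ _
  have hdeg : ∀ i, γ₂ * t ≤
      SignedER.meanDegree (SignedER.edgeProb k (γ₁ * t⁻¹) (γ₂ * t⁻¹)) i := by
    refine SignedER.le_meanDegree (q := γ₂ * t⁻¹) hP0 (fun i j hij => ?_) ?_
    · rcases SignedER.blockExtend_two_of_ne (SignedER.bisection k) (γ₁ * t⁻¹) (γ₂ * t⁻¹) hij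
        with h | h
      · exact hqp.trans_eq h.symm
      · exact h.symm.le
    -- Bounding every edge probability below by q gives degree at least (2k − 1)q ≥ kq = γ₂t.
    have h4 : γ₂ * t = t ^ 2 * (γ₂ * t⁻¹) := by field_simp
    rw [h4]
    gcongr
    push_cast
    rw [← hkt]
    linarith
  have hmain := htail (P := SignedER.edgeProb k (γ₁ * t⁻¹) (γ₂ * t⁻¹)) (S := SignedER.signProb k s) (p := γ₁ * t⁻¹) (m := γ₂ * t) (κ := κ)
    (SignedER.blockExtend_isSymm _ (SignedER.isSymm_two _ _))
    (SignedER.blockExtend_isSymm _ (SignedER.isSymm_two _ _)) hP0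
    (SignedER.blockExtend_two_mem_Icc _ (Set.mem_Icc.2 ⟨by positivity, le_rfl⟩)
      (Set.mem_Icc.2 ⟨by positivity, hqp⟩))
    hp1
    (SignedER.blockExtend_two_mem_Icc _ (Set.mem_Icc.2 ⟨hs₀.le, by linarith⟩)
      (Set.mem_Icc.2 ⟨by linarith, by linarith⟩))
    (hnp ▸ h2) (by positivity) hdeg
    (by rw [hnp, hκ]; apply le_of_eq; field_simp)
  rw [hnp] at hmain
  have eK : (2 + 8 * κ) * (C * Real.sqrt (2 * γ₁ * t)) / (γ₂ * t) =
      (2 + 8 * κ) * (C * Real.sqrt (2 * γ₁)) / γ₂ * (Real.sqrt t)⁻¹ := by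
    rw [Real.sqrt_mul (by positivity)]
    have hst : 0 < Real.sqrt t := Real.sqrt_pos.2 ht0
    have h5 : t = Real.sqrt t * Real.sqrt t := (Real.mul_self_sqrt ht0.le).symm
    generalize Real.sqrt t = w at *
    rw [h5]
    field_simp
  rw [eK] at hmain
  refine SignedER.ofReal_one_sub_le_of_hasLaw hG (fun g => SignedER.opNorm
    (g.normalizedLaplacian - SignedER.signedBlockMeanLaplacian k (γ₁ * t⁻¹) (γ₂ * t⁻¹) s)) (hmain.trans (le_trans ?_ h3))
  -- As γ₁ > γ₂/10, all three error terms are at most 2t² exp(−γ₂t/10), which is the source of the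
  -- 6.
  have h6 : Real.exp (-(2 * γ₁ * t) / 2) ≤ Real.exp (-(γ₂ / 10) * t) :=
    Real.exp_le_exp.2 (by nlinarith)
  have h7 : -(γ₂ * t) / 10 = -(γ₂ / 10) * t := by ring
  push_cast
  rw [h7, hkt]
  nlinarith [mul_le_mul_of_nonneg_left h6 (by positivity : 0 ≤ t ^ 2)]
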